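/- Let $L>0$ and let $S$ be the circle of circumference $L$. For $k\ge 0$ let $H^k(S)$ be the usual real Sobolev space and $V^k(S)=\{f\in H^k(S): \int_0^L f\,dz=0\}$, with norm $\|f\|_{V^k}=\bigl(\int_0^L|\partial_z^k f|^2\,dz\bigr)^{1/2}$. Consider on $S$ the system $$u_t+v\,u_z=0,\qquad \omega_t+v\,\omega_z=u_z,\qquad v_z=H\omega,\qquad \int_0^L v\,dz=0,$$ where $H\omega(z)=\frac1L\,\mathrm{PV}\!\int_0^L\omega(y)\cot\bigl[\tfrac{\pi}{L}(z-y)\bigr]\,dy$. The time derivatives are taken in $L^2(S)$, at every $t\in[0,T]$ (one-sided at $0$ and $T$). Let $m\ge 1$ be an integer, let $T>0$, and let $u\in C([0,T];V^2(S))$, $\omega\in C([0,T];V^1(S))$ be a solution of this system whose initial data satisfy $u(\cdot,0)\in V^{m+1}(S)$ and $\omega(\cdot,0)\in V^m(S)$. Then $$u\in C([0,T];V^{m+1}(S)),\qquad \omega\in C([0,T];V^m(S)).$$ In particular, if $u(\cdot,0),\omega(\cdot,0)\in C^\infty(S)$, then $u(\cdot,t),\omega(\cdot,t)\in C^\infty(S)$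 for every $t\in[0,T]$. The same holds when $u$ is not required to have zero mean, that is, with $H^2(S)$ and $H^{m+1}(S)$ in place of $V^2(S)$ and $V^{m+1}(S)$ in the assumptions and the conclusion on $u$ ($\omega$ still having zero mean). -/

import Mathlib

open MeasureTheory Filter Topology Set
open scoped ContDiff

namespace WallModel

noncomputable section

/-- Real `L²` on the circle `S` of circumference `L`, for the measure of total mass `L`. -/
abbrev L2S (L : ℝ) [Fact (0 < L)] : Type :=
  Lp ℝ 2 (volume : Measure (AddCircle L))

/-- `g` is the weak `k`-th derivative of `f` on the circle:
`∫₀ᴸ f ∂ᵏφ = (-1)ᵏ ∫₀ᴸ g φ` for all smooth `L`-periodic test functions `φ`. -/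
def IsWeakDeriv {L : ℝ} [Fact (0 < L)] (k : ℕ) (f g : L2S L) : Prop :=
  ∀ φ : ℝ → ℝ, ContDiff ℝ ∞ φ → Function.Periodic φ L →
    ∫ x in (0 : ℝ)..L, f (x : AddCircle L) * iteratedDeriv k φ x =
      (-1) ^ k * ∫ x in (0 : ℝ)..L, g (x : AddCircle L) * φ x

open Classical in
/-- The weak `k`-th derivative `∂ᵏf ∈ L²(S)` (unique when it exists; `0` otherwise). -/
def weakDeriv {L : ℝ} [Fact (0 < L)] (k : ℕ) (f : L2S L) : L2S L :=
  if h : ∃ g : L2S L, IsWeakDeriv k f g then h.choose else 0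

/-- The Sobolev space `Hᵏ(S)`: all weak derivatives up to order `k` exist in `L²(S)`. -/
def sobolevH (L : ℝ) [Fact (0 < L)] (k : ℕ) : Set (L2S L) :=
  {f | ∀ j ≤ k, ∃ g : L2S L, IsWeakDeriv j f g}

/-- The mean `(1/L) ∫₀ᴸ f`. -/
def mean {L : ℝ} [Fact (0 < L)] (f : L2S L) : ℝ :=
  (1 / L) * ∫ x in (0 : ℝ)..L, f (x : AddCircle L)

/-- `Vᵏ(S)`: the functions in `Hᵏ(S)` with zero mean. -/
def sobolevV (L : ℝ) [Fact (0 < L)] (k : ℕ) : Set (L2S L) :=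
  {f | f ∈ sobolevH L k ∧ mean f = 0}

/-- The norm of `Vᵏ(S)`, namely `‖f‖ = (∫₀ᴸ |∂ᵏf|²)^{1/2}`. -/
def normV {L : ℝ} [Fact (0 < L)] (k : ℕ) (f : L2S L) : ℝ :=
  ‖weakDeriv k f‖

/-- The norm of `Hᵏ(S)`, namely `‖f‖ = (∑_{j ≤ k} ∫₀ᴸ |∂ʲf|²)^{1/2}`. -/
def normH {L : ℝ} [Fact (0 < L)] (k : ℕ) (f : L2S L) : ℝ :=
  Real.sqrt (∑ j ∈ Finset.range (k + 1), ‖weakDeriv j f‖ ^ 2)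

/-- `f ∈ C([0,T]; Vᵏ(S))`. -/
def ContinuousInV {L : ℝ} [Fact (0 < L)] (k : ℕ) (T : ℝ) (f : ℝ → L2S L) : Prop :=
  ∀ t ∈ Icc 0 T, f t ∈ sobolevV L k ∧
    Tendsto (fun s => normV k (f s - f t)) (𝓝[Icc 0 T] t) (𝓝 0)

/-- `f ∈ C([0,T]; Hᵏ(S))`. -/
def ContinuousInH {L : ℝ} [Fact (0 < L)] (k : ℕ) (T : ℝ) (f : ℝ → L2S L) : Prop :=
  ∀ t ∈ Icc 0 T, f t ∈ sobolevH L k ∧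
    Tendsto (fun s => normH k (f s - f t)) (𝓝[Icc 0 T] t) (𝓝 0)

/-- `f ∈ C^∞(S)`: `f` is represented by a smooth `L`-periodic function. -/
def IsSmooth {L : ℝ} [Fact (0 < L)] (f : L2S L) : Prop :=
  ∃ φ : ℝ → ℝ, ContDiff ℝ ∞ φ ∧ Function.Periodic φ L ∧
    (fun x : ℝ => f (x : AddCircle L)) =ᵐ[volume] φ

/-- The truncated integral `(1/L) ∫ w(y) cot(π(z - y)/L) dy` over the points `y` of the circle
at distance at least `ε` from `z`, written with `s = z - y`. -/
def hilbertTrunc {L : ℝ} [Fact (0 < L)] (w : L2S L) (z : AddCircle L) (ε : ℝ) : ℝ :=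
  (1 / L) * ∫ s in ε..(L - ε), w (z - (s : AddCircle L)) * Real.cot (Real.pi / L * s)

/-- `g = Hw`, the periodic Hilbert transform as a principal value:
`g(z) = (1/L) PV ∫₀ᴸ w(y) cot(π(z - y)/L) dy` for almost every `z`. -/
def IsHilbertTransform {L : ℝ} [Fact (0 < L)] (w g : L2S L) : Prop :=
  ∀ᵐ z : AddCircle L, Tendsto (hilbertTrunc w z) (𝓝[>] 0) (𝓝 (g z))

/-- `v` is the velocity generated by `w`: it has zero mean and `v_z = Hw`. -/
def IsVelocity {L : ℝ} [Fact (0 < L)] (w v : L2S L) : Prop :=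
  v ∈ sobolevV L 1 ∧ IsHilbertTransform w (weakDeriv 1 v)

/-- With `w` the vorticity, `(u, w)` solves `u_t + v u_z = 0`, `w_t + v w_z = u_z`, `v_z = Hw`, `v` of zero mean, on
`[0,T]`: for every `t` in `[0,T]` the time derivatives exist in `L²(S)` (one-sided at `0` and `T`)
and satisfy the equations. -/
def IsSolution {L : ℝ} [Fact (0 < L)] (T : ℝ) (u w : ℝ → L2S L) : Prop :=
  ∃ v ut wt : ℝ → L2S L, ∀ t ∈ Icc 0 T,
    IsVelocity (w t) (v t) ∧
    HasDerivWithinAt u (ut t) (Icc 0 T) t ∧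
    HasDerivWithinAt w (wt t) (Icc 0 T) t ∧
    (∀ᵐ z : AddCircle L, ut t z + v t z * weakDeriv 1 (u t) z = 0) ∧
    (∀ᵐ z : AddCircle L, wt t z + v t z * weakDeriv 1 (w t) z = weakDeriv 1 (u t) z)

end

end WallModel

/-!
The theorem is an energy estimate for the Fourier coefficients of the solution; the order `m` is
treated at once, without induction. Write `b = ω̂`, `c = v̂` and `p = (u_z)^`. On `H¹` the principal
value Hilbert transform is the multiplier `-i sgn n` (`coef_of_isHilbertTransform`), so
`|2πin/L · c n| ≤ |b n|`: the velocity is one derivative smoother than `ω`. Differentiating the first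
equation once, `u_z` and `ω` both solve a transport equation `f_t + v f_z = g` with a right side `g`
of order zero in `(u_z, ω)`.

Let `W_N(k) = min(|k|, N) ^ m` and `E_N(t) = ∑ W_N(k)² (|p k|² + |b k|²)`. The symbols `W_N` satisfy,
with constants independent of `N`, the tame inequalities `W(k) ≲ W(k - n) + W(n)` and
`|W(k) - W(n)| |n| ≲ |k - n| W(n) + W(k - n) |n|` (`weight_le_add`, `abs_weight_sub_mul_le`). Since
`v ∂_z` is antisymmetric up to `v_z`, these and Young's inequality bound the transport term without
loss of a derivative (`enorm_re_transport_le`), and the norms of `u` in `H²` and of `ω` in `H¹`,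
bounded on `[0, T]`, control the remaining factors (`enorm_energy_rate_le`). Because `W_N` is bounded,
`E_N` is a quadratic form that is continuous on `H² × L²` and is differentiable along the solution
although the time derivatives exist only in `L²` (`hasDerivWithinAt_inner_of_symm`).

Hence `|E_N'| ≤ C E_N` with `C` independent of `N`. By Gronwall's inequality `E_N` is bounded and
Lipschitz in time uniformly in `N`, so the limit `E(t) = ∑ |k|^{2m} (|p k|² + |b k|²)` as `N → ∞` is
finite and Lipschitz. Continuity of `E`, which is the square of the top norm, together with continuity
of each Fourier coefficient gives continuity in the strong sense (`tendsto_tsum_norm_sub_sq`,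
`propagation`). Smoothness is membership in every `Hᵏ`, read off from Fourier coefficients.
-/

open scoped ENNReal

namespace WallModel

open AddCircle ComplexConjugate

noncomputable section

section

variable {L : ℝ} [hL : Fact (0 < L)]

/-! ### Fourier coefficients of real square integrable functions -/

/-- Parseval's identity in polarized form, for functions instead of elements of `Lp`. -/
theorem hasSum_conj_fourierCoeff_mul {F G : AddCircle L → ℂ}
    (hF : MemLp F 2 haarAddCircle) (hG : MemLp G 2 haarAddCircle) :
    HasSum (fun n : ℤ => conj (fourierCoeff F n) * fourierCoeff G n)
      (∫ z, conj (F z) * G z ∂haarAddCircle) := by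
  have h := fourierBasis.hasSum_inner_mul_inner (hF.toLp F) (hG.toLp G)
  have e1 : ∀ n, inner ℂ (hF.toLp F) (fourierBasis n) = conj (fourierCoeff F n) := by
    intro n
    rw [← inner_conj_symm, ← fourierBasis.repr_apply_apply, fourierBasis_repr,
      fourierCoeff_congr_ae hF.coeFn_toLp]
  have e2 : ∀ n, inner ℂ (fourierBasis n) (hG.toLp G) = fourierCoeff G n := by
    intro n
    rw [← fourierBasis.repr_apply_apply, fourierBasis_repr,
      fourierCoeff_congr_ae hG.coeFn_toLp]
  simp only [e1, e2] at h
  convert! h using 1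
  rw [L2.inner_def]
  apply integral_congr_ae
  filter_upwards [hF.coeFn_toLp, hG.coeFn_toLp] with z h1 h2
  rw [h1, h2, RCLike.inner_apply']

/-- The `n`-th Fourier coefficient of a real square integrable function on the circle. -/
def coef (f : L2S L) (n : ℤ) : ℂ := fourierCoeff (fun z => (f z : ℂ)) n

theorem memLp_ofReal (f : L2S L) : MemLp (fun z => (f z : ℂ)) 2 haarAddCircle :=
  ((Lp.memLp f).ofReal (K := ℂ)).haarAddCircle

theorem ae_haar_iff {p : AddCircle L → Prop} :
    (∀ᵐ z ∂haarAddCircle, p z) ↔ ∀ᵐ z : AddCircle L, p z := by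
  rw [volume_eq_smul_haarAddCircle]
  rw [Measure.ae_ennreal_smul_measure_iff]
  simpa using hL.out

theorem coef_congr {f : L2S L} {F : AddCircle L → ℂ} (h : ∀ᵐ z, (f z : ℂ) = F z) (n : ℤ) :
    coef f n = fourierCoeff F n :=
  congrFun (fourierCoeff_congr_ae (ae_haar_iff.2 h)) n

theorem coef_add (f g : L2S L) (n : ℤ) : coef (f + g) n = coef f n + coef g n := by
  have := congrFun (fourierCoeff.add (f := fun z => (f z : ℂ)) (g := fun z => (g z : ℂ))
    ((memLp_ofReal f).integrable (by norm_num)) ((memLp_ofReal g).integrable (by norm_num))) n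
  rw [Pi.add_apply] at this
  rw [coef.eq_1 f, coef.eq_1 g, ← this]
  apply coef_congr
  filter_upwards [Lp.coeFn_add f g] with z hz
  rw [hz, Pi.add_apply, Pi.add_apply, Complex.ofReal_add]

theorem coef_smul (r : ℝ) (f : L2S L) (n : ℤ) : coef (r • f) n = r * coef f n := by
  rw [coef, coef, ← fourierCoeff.const_mul]
  apply coef_congr
  filter_upwards [Lp.coeFn_smul r f] with z hz
  simp [hz]

theorem coef_neg (f : L2S L) (n : ℤ) : coef (-f) n = -coef f n := by
  simpa using coef_smul (-1) f n

theorem coef_sub (f g : L2S L) (n : ℤ) : coef (f - g) n = coef f n - coef g n := by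
  rw [sub_eq_add_neg, coef_add, coef_neg, sub_eq_add_neg]

theorem fourierCoeff_conj (F : AddCircle L → ℂ) (n : ℤ) :
    fourierCoeff (fun z => conj (F z)) n = conj (fourierCoeff F (-n)) := by
  rw [fourierCoeff, fourierCoeff, ← integral_conj]
  congr 1
  ext z
  simp only [smul_eq_mul, map_mul, ← fourier_neg, neg_neg]

theorem coef_neg_index (f : L2S L) (n : ℤ) : coef f (-n) = conj (coef f n) := by
  have := fourierCoeff_conj (fun z => (f z : ℂ)) (-n)
  simp only [Complex.conj_ofReal, neg_neg] at this
  exact this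

/-- Parseval's identity for the real inner product; the factor `L` is the mass of the circle. -/
theorem hasSum_conj_coef_mul (f g : L2S L) :
    HasSum (fun n : ℤ => conj (coef f n) * coef g n) (((inner ℝ f g / L : ℝ)) : ℂ) := by
  have h := hasSum_conj_fourierCoeff_mul (memLp_ofReal f) (memLp_ofReal g)
  convert! h using 1
  rw [integral_haarAddCircle, L2.inner_def]
  simp only [Complex.conj_ofReal, ← Complex.ofReal_mul]
  rw [integral_complex_ofReal]
  simp only [RCLike.inner_apply', conj_trivial, Complex.real_smul]
  push_cast
  ring

theorem hasSum_norm_coef_sq (f : L2S L) :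
    HasSum (fun n : ℤ => ‖coef f n‖ ^ 2) (‖f‖ ^ 2 / L) := by
  have h := hasSum_conj_coef_mul f f
  rw [real_inner_self_eq_norm_sq] at h
  have := Complex.hasSum_re h
  rw [Complex.ofReal_re] at this
  convert! this using 2 with n
  rw [mul_comm, Complex.mul_conj, ← Complex.sq_norm, Complex.ofReal_re]

theorem norm_coef_sq_le (f : L2S L) (n : ℤ) : ‖coef f n‖ ^ 2 ≤ ‖f‖ ^ 2 / L :=
  le_hasSum (hasSum_norm_coef_sq f) n fun _ _ => sq_nonneg _

theorem coef_injective {f g : L2S L} (h : ∀ n, coef f n = coef g n) : f = g := by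
  have h1 := hasSum_norm_coef_sq (f - g)
  simp only [coef_sub, h, sub_self, norm_zero] at h1
  have hz : HasSum (fun _ : ℤ => (0 : ℝ) ^ 2) 0 := by simp
  have h2 := h1.unique hz
  rw [div_eq_zero_iff, or_iff_left hL.out.ne', sq_eq_zero_iff, norm_eq_zero, sub_eq_zero] at h2
  exact h2

/-- Riesz–Fischer: a square summable sequence with the symmetry of real functions is the sequence
of Fourier coefficients of a real function. -/
theorem exists_coef_eq {c : ℤ → ℂ} (hc : Summable fun n => ‖c n‖ ^ 2)
    (hsymm : ∀ n, c (-n) = conj (c n)) : ∃ f : L2S L, ∀ n, coef f n = c n := by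
  have hm : Memℓp c 2 := by
    rw [memℓp_gen_iff (by norm_num)]
    simpa using hc
  let F : Lp ℂ 2 (haarAddCircle (T := L)) := fourierBasis.repr.symm ⟨c, hm⟩
  have hF : ∀ n, fourierCoeff F n = c n := by
    intro n
    rw [← fourierBasis_repr]
    simp [F]
  have hFm : MemLp (fun z => (F z).re) 2 (volume : Measure (AddCircle L)) :=
    (Lp.memLp F).of_haarAddCircle.re
  refine ⟨hFm.toLp _, fun n => ?_⟩
  have h1 : coef (hFm.toLp _) n = fourierCoeff (fun z => (((F z).re : ℝ) : ℂ)) n := by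
    apply coef_congr
    filter_upwards [hFm.coeFn_toLp] with z hz
    rw [hz]
  rw [h1]
  have hi : Integrable (F : AddCircle L → ℂ) haarAddCircle := (Lp.memLp F).integrable (by norm_num)
  have hi' : Integrable (fun z => conj (F z)) haarAddCircle :=
    (Lp.memLp F).star.integrable (by norm_num)
  have h2 : (fun z => (((F z).re : ℝ) : ℂ))
      = fun z => (1 / 2 : ℂ) * ((F : AddCircle L → ℂ) + fun z => conj (F z)) z := by
    ext z
    simp only [Pi.add_apply, Complex.add_conj]
    push_cast
    ring
  rw [h2, fourierCoeff.const_mul, fourierCoeff.add hi hi', Pi.add_apply, fourierCoeff_conj, hF, hF,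
    hsymm, Complex.conj_conj]
  ring

/-- The Fourier coefficients of a product are given by convolution. -/
theorem hasSum_coef_mul (f g : L2S L) (k : ℤ) :
    HasSum (fun n : ℤ => coef f (k - n) * coef g n)
      (fourierCoeff (fun z => ((f z * g z : ℝ) : ℂ)) k) := by
  have hm : MemLp (fun z => fourier k z * (f z : ℂ)) 2 (haarAddCircle (T := L)) := by
    have h := memLp_ofReal f
    refine h.of_le ((map_continuous (fourier k)).aestronglyMeasurable.mul h.1) ?_
    filter_upwards with z
    rw [norm_mul, fourier_apply, Circle.norm_coe, one_mul]
  have h := hasSum_conj_fourierCoeff_mul hm (memLp_ofReal g)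
  convert h using 1
  · ext n
    congr 1
    rw [← neg_sub n k, coef_neg_index, coef, fourierCoeff, fourierCoeff]
    congr 2
    ext z
    rw [show -(n - k) = -n + k by ring, fourier_add]
    simp only [smul_eq_mul]
    ring
  · rw [fourierCoeff]
    congr 1
    ext z
    rw [fourier_neg]
    simp only [smul_eq_mul, map_mul, Complex.conj_ofReal, Complex.ofReal_mul]
    ring

end

section

variable {L : ℝ}

/-! ### Weak derivatives, Sobolev spaces and smoothness in terms of Fourier coefficients -/

/-- The Fourier symbol `2πin/L` of `∂_z` on the circle of circumference `L`. -/
def symb (L : ℝ) (n : ℤ) : ℂ := 2 * Real.pi * Complex.I * n / L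

theorem symb_neg (n : ℤ) : symb L (-n) = -symb L n := by
  simp [symb]; ring

theorem symb_sub (n k : ℤ) : symb L (n - k) = symb L n - symb L k := by
  simp [symb]; ring

theorem conj_symb (n : ℤ) : conj (symb L n) = -symb L n := by
  simp [symb, Complex.conj_ofNat]; ring

theorem symb_zero : symb L 0 = 0 := by simp [symb]

theorem fourier_eq_exp (n : ℤ) (x : ℝ) :
    fourier n (x : AddCircle L) = Complex.exp (symb L n * x) := by
  rw [fourier_coe_apply, symb]
  congr 1
  ring

theorem periodic_deriv {φ : ℝ → ℝ} (hp : Function.Periodic φ L) :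
    Function.Periodic (deriv φ) L := by
  intro x
  rw [← deriv_comp_add_const]
  congr 1
  ext y
  exact hp y

theorem periodic_iteratedDeriv {φ : ℝ → ℝ} (hp : Function.Periodic φ L) (k : ℕ) :
    Function.Periodic (iteratedDeriv k φ) L := by
  induction k with
  | zero => simpa using hp
  | succ k ih => rw [iteratedDeriv_succ]; exact periodic_deriv ih

variable [hL : Fact (0 < L)]

theorem norm_symb (n : ℤ) : ‖symb L n‖ = 2 * Real.pi / L * |(n : ℝ)| := by
  have := hL.out
  simp [symb, abs_of_pos Real.pi_pos, abs_of_pos this]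
  ring

theorem symb_ne_zero {n : ℤ} (hn : n ≠ 0) : symb L n ≠ 0 := by
  have := hL.out
  rw [← norm_ne_zero_iff, norm_symb]
  have : (0 : ℝ) < |(n : ℝ)| := by positivity
  have := Real.pi_pos
  positivity

theorem hasDerivAt_exp_mul (s : ℂ) (x : ℝ) :
    HasDerivAt (fun x : ℝ => Complex.exp (s * x)) (s * Complex.exp (s * x)) x := by
  have h : HasDerivAt (fun x : ℝ => s * (x : ℂ)) s x := by
    simpa using (Complex.ofRealCLM.hasDerivAt (x := x)).const_mul s
  simpa [mul_comm] using h.cexp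

theorem iteratedDeriv_exp_mul (s : ℂ) (k : ℕ) :
    iteratedDeriv k (fun x : ℝ => Complex.exp (s * x)) =
      fun x : ℝ => s ^ k * Complex.exp (s * x) := by
  induction k with
  | zero => simp
  | succ k ih =>
    rw [iteratedDeriv_succ, ih]
    ext x
    rw [((hasDerivAt_exp_mul s x).const_mul (s ^ k)).deriv]
    ring

theorem iteratedDeriv_re_exp_mul (A s : ℂ) (k : ℕ) :
    iteratedDeriv k (fun x : ℝ => (A * Complex.exp (s * x)).re) =
      fun x : ℝ => (A * s ^ k * Complex.exp (s * x)).re := by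
  induction k with
  | zero => simp
  | succ k ih =>
    rw [iteratedDeriv_succ, ih]
    ext x
    have h := ((hasDerivAt_exp_mul s x).const_mul (A * s ^ k))
    have h2 := (Complex.reCLM.hasFDerivAt.comp_hasDerivAt x h).deriv
    simp only [Function.comp_def, Complex.reCLM_apply] at h2
    rw [h2]
    congr 1
    ring

theorem contDiff_exp_mul (s : ℂ) : ContDiff ℝ ∞ (fun x : ℝ => Complex.exp (s * x)) :=
  (contDiff_const.mul Complex.ofRealCLM.contDiff).cexp

theorem coef_eq_intervalIntegral (f : L2S L) (n : ℤ) :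
    coef f n = (1 / L : ℝ) * ∫ x in (0 : ℝ)..L, Complex.exp (-symb L n * x) * f (x : AddCircle L) := by
  rw [coef, fourierCoeff_eq_intervalIntegral _ _ 0, zero_add]
  simp only [fourier_eq_exp, symb_neg, smul_eq_mul, Complex.real_smul]

theorem integral_mul_re_exp (f : L2S L) (n : ℤ) (A : ℂ) :
    ∫ x in (0 : ℝ)..L, f (x : AddCircle L) * (A * Complex.exp (-symb L n * x)).re =
      L * (A * coef f n).re := by
  have hL' := hL.out
  have hi : IntervalIntegrable
      (fun x : ℝ => Complex.exp (-symb L n * x) * (f (x : AddCircle L) : ℂ)) volume 0 L := by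
    have h1 : Integrable (fun z => (f z : ℂ)) (volume : Measure (AddCircle L)) :=
      ((Lp.memLp f).ofReal (K := ℂ)).integrable (by norm_num)
    have h2 := (AddCircle.measurePreserving_mk L 0).integrable_comp_of_integrable h1
    rw [zero_add] at h2
    have h3 : IntervalIntegrable (fun x : ℝ => (f (x : AddCircle L) : ℂ)) volume 0 L := by
      rw [intervalIntegrable_iff_integrableOn_Ioc_of_le hL'.le]
      exact h2
    exact h3.continuousOn_mul (contDiff_exp_mul _).continuous.continuousOn
  have h4 : (A * coef f n * L) =
      ∫ x in (0 : ℝ)..L, A * (Complex.exp (-symb L n * x) * (f (x : AddCircle L) : ℂ)) := by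
    rw [intervalIntegral.integral_const_mul, coef_eq_intervalIntegral]
    have : (L : ℂ) ≠ 0 := by exact_mod_cast hL'.ne'
    push_cast
    rw [one_div]
    linear_combination (A * ∫ x in (0 : ℝ)..L, Complex.exp (-symb L n * x) * (f (x : AddCircle L) : ℂ))
      * (inv_mul_cancel₀ this)
  have h5 := congrArg Complex.re h4
  rw [Complex.re_mul_ofReal, mul_comm] at h5
  rw [h5]
  have := Complex.reCLM.intervalIntegral_comp_comm (hi.const_mul A)
  simp only [Complex.reCLM_apply] at this
  rw [← this]
  congr 1
  ext x
  rw [← mul_assoc, Complex.re_mul_ofReal, mul_comm]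

theorem coef_of_isWeakDeriv {k : ℕ} {f g : L2S L} (h : IsWeakDeriv k f g) (n : ℤ) :
    coef g n = symb L n ^ k * coef f n := by
  have hL' := hL.out
  have key : ∀ A : ℂ, (A * ((-symb L n) ^ k * coef f n - (-1) ^ k * coef g n)).re = 0 := by
    intro A
    have hper : Function.Periodic (fun x : ℝ => (A * Complex.exp (-symb L n * x)).re) L := by
      intro x
      simp only [← symb_neg, ← fourier_eq_exp]
      simp
    have h1 := h _ (Complex.reCLM.contDiff.comp
      (contDiff_const.mul (contDiff_exp_mul (-symb L n)))) hper
    have e : (Complex.reCLM ∘ fun x : ℝ => A * Complex.exp (-symb L n * x)) =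
      fun x : ℝ => (A * Complex.exp (-symb L n * x)).re := rfl
    simp only [e] at h1
    rw [iteratedDeriv_re_exp_mul] at h1
    simp only [integral_mul_re_exp] at h1
    have h2 : L * ((A * ((-symb L n) ^ k * coef f n - (-1) ^ k * coef g n)).re) = 0 := by
      have h3 : ((-1 : ℂ) ^ k) = (((-1 : ℝ) ^ k : ℝ) : ℂ) := by push_cast; rfl
      have h4 : A * ((-symb L n) ^ k * coef f n - (-1) ^ k * coef g n) =
        A * (-symb L n) ^ k * coef f n - (((-1 : ℝ) ^ k : ℝ) : ℂ) * (A * coef g n) := by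
        rw [h3]; ring
      rw [h4, Complex.sub_re, Complex.re_ofReal_mul, mul_sub, h1]
      ring
    exact (mul_eq_zero.1 h2).resolve_left hL'.ne'
  have h0 : (-symb L n) ^ k * coef f n - (-1) ^ k * coef g n = 0 := by
    apply Complex.ext
    · simpa using key 1
    · simpa using key (-Complex.I)
  have h1 : (-1 : ℂ) ^ k * (symb L n ^ k * coef f n - coef g n) = 0 := by
    rw [← h0, neg_pow (symb L n)]
    ring
  have h2 := (mul_eq_zero.1 h1).resolve_left (pow_ne_zero _ (by norm_num))
  exact (sub_eq_zero.1 h2).symm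

/-- A continuous `L`-periodic function as an element of `L²(S)`. -/
def ofPeriodic (φ : ℝ → ℝ) (hc : Continuous φ) (hp : Function.Periodic φ L) : L2S L :=
  ContinuousMap.toLp 2 volume ℝ
    (⟨hp.lift, continuous_coinduced_dom.2 hc⟩ : C(AddCircle L, ℝ))

theorem ofPeriodic_ae (φ : ℝ → ℝ) (hc : Continuous φ) (hp : Function.Periodic φ L) :
    ∀ᵐ z : AddCircle L, ofPeriodic φ hc hp z = hp.lift z :=
  ContinuousMap.coeFn_toLp (p := 2) (𝕜 := ℝ) volume
    (⟨hp.lift, continuous_coinduced_dom.2 hc⟩ : C(AddCircle L, ℝ))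

theorem coef_ofPeriodic (φ : ℝ → ℝ) (hc : Continuous φ) (hp : Function.Periodic φ L) (n : ℤ) :
    coef (ofPeriodic φ hc hp) n =
      (1 / L : ℝ) * ∫ x in (0 : ℝ)..L, Complex.exp (-symb L n * x) * φ x := by
  rw [coef_congr (F := fun z => ((hp.lift z : ℝ) : ℂ)),
    fourierCoeff_eq_intervalIntegral _ _ 0, zero_add]
  · simp only [fourier_eq_exp, symb_neg, smul_eq_mul, Complex.real_smul,
      Function.Periodic.lift_coe]
  · filter_upwards [ofPeriodic_ae φ hc hp] with z hz
    rw [hz]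

theorem integral_mul_eq_inner_ofPeriodic (f : L2S L) (φ : ℝ → ℝ) (hc : Continuous φ)
    (hp : Function.Periodic φ L) :
    ∫ x in (0 : ℝ)..L, f (x : AddCircle L) * φ x = inner ℝ f (ofPeriodic φ hc hp) := by
  have h := AddCircle.intervalIntegral_preimage L 0 (fun z => f z * hp.lift z)
  simp only [Function.Periodic.lift_coe, zero_add] at h
  rw [h, L2.inner_def]
  apply integral_congr_ae
  filter_upwards [ofPeriodic_ae φ hc hp] with z hz
  rw [hz, RCLike.inner_apply', conj_trivial]

theorem coef_ofPeriodic_deriv (φ : ℝ → ℝ) (hφ : ContDiff ℝ 1 φ) (hp : Function.Periodic φ L)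
    (n : ℤ) :
    coef (ofPeriodic (deriv φ) (hφ.continuous_deriv le_rfl) (periodic_deriv hp)) n =
      symb L n * coef (ofPeriodic φ hφ.continuous hp) n := by
  rw [coef_ofPeriodic, coef_ofPeriodic]
  have hd : ∀ x : ℝ, HasDerivAt (fun x : ℝ => Complex.exp (-symb L n * x) * (φ x : ℂ))
      ((-symb L n * Complex.exp (-symb L n * x)) * φ x +
        Complex.exp (-symb L n * x) * (deriv φ x : ℝ)) x := fun x =>
    (hasDerivAt_exp_mul _ x).mul ((hφ.differentiable one_ne_zero x).hasDerivAt.ofReal_comp)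
  have c1 : Continuous fun x : ℝ => Complex.exp (-symb L n * x) := (contDiff_exp_mul _).continuous
  have c2 : Continuous fun x : ℝ => (φ x : ℂ) := Complex.continuous_ofReal.comp hφ.continuous
  have c3 : Continuous fun x : ℝ => ((deriv φ x : ℝ) : ℂ) :=
    Complex.continuous_ofReal.comp (hφ.continuous_deriv le_rfl)
  have i1 : IntervalIntegrable (fun x : ℝ => -symb L n * Complex.exp (-symb L n * x) * φ x)
      volume 0 L := ((continuous_const.mul c1).mul c2).intervalIntegrable _ _
  have i3 : IntervalIntegrable (fun x : ℝ => Complex.exp (-symb L n * x) * (deriv φ x : ℝ))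
      volume 0 L := (c1.mul c3).intervalIntegrable _ _
  have h := intervalIntegral.integral_eq_sub_of_hasDerivAt (a := 0) (b := L)
    (fun x _ => hd x) ((i1.add i3))
  have hbd : Complex.exp (-symb L n * (L : ℝ)) * (φ L : ℂ) -
      Complex.exp (-symb L n * (0 : ℝ)) * (φ 0 : ℂ) = 0 := by
    have h0 : φ L = φ 0 := by simpa using hp 0
    rw [← symb_neg, ← fourier_eq_exp, ← fourier_eq_exp, h0, AddCircle.coe_period]
    simp
  rw [hbd, intervalIntegral.integral_add i1 i3] at h
  simp only [mul_assoc] at h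
  rw [intervalIntegral.integral_const_mul] at h
  rw [eq_neg_of_add_eq_zero_right h]
  ring

theorem coef_ofPeriodic_iteratedDeriv (φ : ℝ → ℝ) (hφ : ContDiff ℝ ∞ φ)
    (hp : Function.Periodic φ L) (k : ℕ) (n : ℤ) :
    coef (ofPeriodic (iteratedDeriv k φ) (hφ.continuous_iteratedDeriv k (by exact_mod_cast le_top))
      (periodic_iteratedDeriv hp k)) n = symb L n ^ k * coef (ofPeriodic φ hφ.continuous hp) n := by
  induction k with
  | zero => simp
  | succ k ih =>
    have hs : ContDiff ℝ 1 (iteratedDeriv k φ) := by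
      rw [iteratedDeriv_eq_iterate]
      exact ContDiff.iterate_deriv' 1 k (hφ.of_le (by exact_mod_cast le_top))
    have := coef_ofPeriodic_deriv (iteratedDeriv k φ) hs (periodic_iteratedDeriv hp k) n
    simp only [← iteratedDeriv_succ] at this
    rw [this, ih]
    ring

theorem isWeakDeriv_iff {k : ℕ} {f g : L2S L} :
    IsWeakDeriv k f g ↔ ∀ n, coef g n = symb L n ^ k * coef f n := by
  refine ⟨coef_of_isWeakDeriv, fun h φ hφ hp => ?_⟩
  have hL' := hL.out
  rw [integral_mul_eq_inner_ofPeriodic f _ (hφ.continuous_iteratedDeriv k (by exact_mod_cast le_top))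
      (periodic_iteratedDeriv hp k), integral_mul_eq_inner_ofPeriodic g _ hφ.continuous hp]
  have h1 := hasSum_conj_coef_mul f (ofPeriodic (iteratedDeriv k φ)
    (hφ.continuous_iteratedDeriv k (by exact_mod_cast le_top)) (periodic_iteratedDeriv hp k))
  have h2 := (hasSum_conj_coef_mul g (ofPeriodic φ hφ.continuous hp)).mul_left ((-1) ^ k)
  have h3 : ∀ n, conj (coef f n) * coef (ofPeriodic (iteratedDeriv k φ)
      (hφ.continuous_iteratedDeriv k (by exact_mod_cast le_top)) (periodic_iteratedDeriv hp k)) n =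
      (-1) ^ k * (conj (coef g n) * coef (ofPeriodic φ hφ.continuous hp) n) := by
    intro n
    rw [coef_ofPeriodic_iteratedDeriv φ hφ hp, h n, map_mul, map_pow, conj_symb, neg_pow (symb L n)]
    rw [show (-1 : ℂ) ^ k * ((-1) ^ k * symb L n ^ k * conj (coef f n) *
      coef (ofPeriodic φ hφ.continuous hp) n) = ((-1) ^ k * (-1) ^ k) * (symb L n ^ k *
      conj (coef f n) * coef (ofPeriodic φ hφ.continuous hp) n) by ring, ← mul_pow]
    simp
    ring
  simp only [h3] at h1
  have h4 := h1.unique h2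
  have h5 : inner ℝ f (ofPeriodic (iteratedDeriv k φ)
      (hφ.continuous_iteratedDeriv k (by exact_mod_cast le_top)) (periodic_iteratedDeriv hp k)) / L
      = (-1) ^ k * (inner ℝ g (ofPeriodic φ hφ.continuous hp) / L) := by
    apply Complex.ofReal_injective
    rw [h4]
    push_cast
    rfl
  field_simp at h5
  exact h5

theorem exists_isWeakDeriv_iff {k : ℕ} {f : L2S L} :
    (∃ g, IsWeakDeriv k f g) ↔ Summable fun n : ℤ => (|(n : ℝ)| ^ k * ‖coef f n‖) ^ 2 := by
  have hL' := hL.out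
  have hpi := Real.pi_pos
  have e : ∀ n, ‖symb L n ^ k * coef f n‖ ^ 2 =
      ((2 * Real.pi / L) ^ k) ^ 2 * (|(n : ℝ)| ^ k * ‖coef f n‖) ^ 2 := by
    intro n
    rw [norm_mul, norm_pow, norm_symb, mul_pow]
    ring
  constructor
  · rintro ⟨g, hg⟩
    have h := (hasSum_norm_coef_sq g).summable
    simp only [isWeakDeriv_iff.1 hg, e] at h
    exact (summable_mul_left_iff (by positivity)).1 h
  · intro h
    obtain ⟨g, hg⟩ := exists_coef_eq (L := L) (c := fun n => symb L n ^ k * coef f n)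
      (by simp only [e]; exact h.mul_left _)
      (fun n => by
        rw [symb_neg, coef_neg_index, map_mul, map_pow, conj_symb])
    exact ⟨g, isWeakDeriv_iff.2 hg⟩

theorem mem_sobolevH_iff {k : ℕ} {f : L2S L} :
    f ∈ sobolevH L k ↔ Summable fun n : ℤ => (|(n : ℝ)| ^ k * ‖coef f n‖) ^ 2 := by
  rw [← exists_isWeakDeriv_iff]
  refine ⟨fun h => h k le_rfl, fun h j hj => ?_⟩
  rw [exists_isWeakDeriv_iff] at h ⊢
  refine ((hasSum_norm_coef_sq f).summable.add h).of_nonneg_of_le (fun _ => sq_nonneg _) fun n => ?_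
  have h0 := sq_nonneg ‖coef f n‖
  rcases eq_or_ne n 0 with rfl | hn
  · have h1 : (|((0 : ℤ) : ℝ)| ^ j) ≤ 1 := pow_le_one₀ (by simp) (by simp)
    have h2 : (|((0 : ℤ) : ℝ)| ^ j * ‖coef f 0‖) ^ 2 ≤ ‖coef f 0‖ ^ 2 := by
      apply pow_le_pow_left₀ (by positivity)
      exact mul_le_of_le_one_left (norm_nonneg _) h1
    have := sq_nonneg (|((0 : ℤ) : ℝ)| ^ k * ‖coef f 0‖)
    linarith
  · have h1 : (1 : ℝ) ≤ |(n : ℝ)| := by exact_mod_cast Int.one_le_abs hn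
    have h2 : (|(n : ℝ)| ^ j * ‖coef f n‖) ^ 2 ≤ (|(n : ℝ)| ^ k * ‖coef f n‖) ^ 2 := by
      gcongr
    linarith

theorem coef_weakDeriv {k : ℕ} {f : L2S L} (h : f ∈ sobolevH L k) (n : ℤ) :
    coef (weakDeriv k f) n = symb L n ^ k * coef f n := by
  have h' := h k le_rfl
  rw [weakDeriv, dif_pos h']
  exact isWeakDeriv_iff.1 h'.choose_spec n

theorem sub_mem_sobolevH {k : ℕ} {f g : L2S L} (hf : f ∈ sobolevH L k) (hg : g ∈ sobolevH L k) :
    f - g ∈ sobolevH L k := by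
  intro j hj
  obtain ⟨f', hf'⟩ := hf j hj
  obtain ⟨g', hg'⟩ := hg j hj
  refine ⟨f' - g', isWeakDeriv_iff.2 fun n => ?_⟩
  rw [coef_sub, coef_sub, isWeakDeriv_iff.1 hf', isWeakDeriv_iff.1 hg']
  ring

theorem weakDeriv_sub {k : ℕ} {f g : L2S L} (hf : f ∈ sobolevH L k) (hg : g ∈ sobolevH L k) :
    weakDeriv k (f - g) = weakDeriv k f - weakDeriv k g := by
  apply coef_injective
  intro n
  rw [coef_weakDeriv (sub_mem_sobolevH hf hg), coef_sub, coef_sub, coef_weakDeriv hf,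
    coef_weakDeriv hg]
  ring

theorem sobolevH_mono {j k : ℕ} (hjk : j ≤ k) {f : L2S L} (hf : f ∈ sobolevH L k) :
    f ∈ sobolevH L j := fun i hi => hf i (hi.trans hjk)

theorem mem_sobolevH_zero (f : L2S L) : f ∈ sobolevH L 0 :=
  mem_sobolevH_iff.2 (by simpa using (hasSum_norm_coef_sq f).summable)

theorem weakDeriv_zero (f : L2S L) : weakDeriv 0 f = f :=
  coef_injective fun n => by rw [coef_weakDeriv (mem_sobolevH_zero f), pow_zero, one_mul]

theorem coef_zero_eq_mean (f : L2S L) : coef f 0 = mean f := by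
  rw [coef_eq_intervalIntegral, mean, symb_zero]
  simp only [neg_zero, zero_mul, Complex.exp_zero, one_mul]
  rw [intervalIntegral.integral_ofReal]
  push_cast
  rfl

theorem mean_eq_zero_iff {f : L2S L} : mean f = 0 ↔ coef f 0 = 0 := by
  rw [coef_zero_eq_mean, Complex.ofReal_eq_zero]

/-- An absolutely convergent Fourier series converges almost everywhere to its function. -/
theorem ae_hasSum_fourier {f : L2S L} (h : Summable fun n => ‖coef f n‖) :
    ∀ᵐ z : AddCircle L, HasSum (fun n => coef f n * fourier n z) (f z) := by
  have hs : Summable fun n : ℤ => coef f n • (fourier n : C(AddCircle L, ℂ)) := by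
    apply Summable.of_norm
    simpa only [norm_smul, fourier_norm, mul_one] using h
  obtain ⟨Ψ, hΨ⟩ := hs
  have h1 := (ContinuousMap.toLp (E := ℂ) 2 (haarAddCircle (T := L)) ℂ).hasSum hΨ
  have h2 := hasSum_fourier_series_L2 ((memLp_ofReal f).toLp _)
  have h3 : ∀ n, fourierCoeff ((memLp_ofReal f).toLp _) n = coef f n := fun n =>
    congrFun (fourierCoeff_congr_ae (memLp_ofReal f).coeFn_toLp) n
  simp only [h3] at h2
  simp only [map_smul] at h1
  have h4 := h1.unique h2
  have h5 : ∀ᵐ z : AddCircle L, Ψ z = (f z : ℂ) := by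
    rw [← ae_haar_iff]
    filter_upwards [ContinuousMap.coeFn_toLp (p := 2) (𝕜 := ℂ) (haarAddCircle (T := L)) Ψ,
      (memLp_ofReal f).coeFn_toLp] with z h6 h7
    rw [← h6, h4, h7]
  filter_upwards [h5] with z hz
  rw [← hz]
  exact hΨ.map (ContinuousMap.evalCLM ℂ z : C(AddCircle L, ℂ) →L[ℂ] ℂ)
    (ContinuousMap.evalCLM ℂ z).continuous

theorem ae_coe_of_ae {p : AddCircle L → Prop} (h : ∀ᵐ z : AddCircle L, p z) :
    ∀ᵐ x : ℝ, p (x : AddCircle L) := by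
  have h1 : ∀ k : ℤ, ∀ᵐ x ∂(volume.restrict (Ioc ((0 : ℝ) + k • L) (0 + (k + 1) • L))),
      p ((x : ℝ) : AddCircle L) := by
    intro k
    have := (AddCircle.measurePreserving_mk L (0 + k • L)).quasiMeasurePreserving.ae h
    rwa [add_assoc, show k • L + L = (k + 1) • L by rw [add_smul, one_smul]] at this
  have h2 := (ae_restrict_iUnion_iff (μ := volume)
    (fun k : ℤ => Ioc ((0 : ℝ) + k • L) (0 + (k + 1) • L)) (fun x : ℝ => p (x : AddCircle L))).2 h1
  rwa [iUnion_Ioc_add_zsmul hL.out, Measure.restrict_univ] at h2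

theorem summable_of_isSmooth {f : L2S L} (h : IsSmooth f) (k : ℕ) :
    Summable fun n : ℤ => (|(n : ℝ)| ^ k * ‖coef f n‖) ^ 2 := by
  obtain ⟨φ, hφ, hp, hae⟩ := h
  have h1 : f = ofPeriodic φ hφ.continuous hp := by
    apply coef_injective
    intro n
    rw [coef_eq_intervalIntegral, coef_ofPeriodic]
    congr 1
    apply intervalIntegral.integral_congr_ae
    filter_upwards [hae] with x hx _
    rw [hx]
  rw [← exists_isWeakDeriv_iff, h1]
  exact ⟨_, isWeakDeriv_iff.2 (coef_ofPeriodic_iteratedDeriv φ hφ hp k)⟩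

theorem mem_sobolevH_of_isSmooth {f : L2S L} (h : IsSmooth f) (k : ℕ) : f ∈ sobolevH L k :=
  mem_sobolevH_iff.2 (summable_of_isSmooth h k)

/-- Square summability of `|n| ^ (k + 1) f̂(n)` gives summability of `|n| ^ k f̂(n)`. -/
theorem summable_of_mem_sobolevH {f : L2S L} {k : ℕ} (h : f ∈ sobolevH L (k + 1)) :
    Summable fun n : ℤ => |(n : ℝ)| ^ k * ‖coef f n‖ := by
  rw [mem_sobolevH_iff] at h
  have h1 : Summable fun n : ℤ => |((n : ℝ))⁻¹| ^ 2 := by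
    have := Real.summable_one_div_int_pow.2 (show 1 < 2 by norm_num)
    simpa using this
  have h3 : Summable fun n : ℤ => |(n : ℝ)| ^ (k + 1) * ‖coef f n‖ * |((n : ℝ))⁻¹| := by
    refine (h.add h1).of_nonneg_of_le (fun _ => by positivity) fun n => ?_
    have := two_mul_le_add_sq (|(n : ℝ)| ^ (k + 1) * ‖coef f n‖) |((n : ℝ))⁻¹|
    have h0 : 0 ≤ |(n : ℝ)| ^ (k + 1) * ‖coef f n‖ * |((n : ℝ))⁻¹| := by positivity
    linarith
  -- the term `n = 0` is lost in the product with `|n|⁻¹`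
  have h4 : Summable fun n : ℤ => if n = 0 then |(n : ℝ)| ^ k * ‖coef f n‖ else 0 :=
    summable_of_ne_finset_zero (s := {0}) fun n hn => by simp at hn; simp [hn]
  refine (h3.add h4).congr fun n => ?_
  rcases eq_or_ne n 0 with rfl | hn
  · simp
  · have : |(n : ℝ)| ≠ 0 := by simpa using hn
    rw [if_neg hn, abs_inv]
    field_simp
    ring

theorem isSmooth_of_forall_mem_sobolevH {f : L2S L} (h : ∀ k, f ∈ sobolevH L k) : IsSmooth f := by
  have hs : ∀ k : ℕ, Summable fun n : ℤ => ‖symb L n‖ ^ k * ‖coef f n‖ := fun k => by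
    refine ((summable_of_mem_sobolevH (h (k + 1))).mul_left ((2 * Real.pi / L) ^ k)).congr
      fun n => ?_
    rw [norm_symb, mul_pow]
    ring
  let Φ : ℝ → ℂ := fun x => ∑' n : ℤ, coef f n * Complex.exp (symb L n * x)
  have hΦ : ContDiff ℝ ∞ Φ := by
    refine contDiff_tsum (𝕜 := ℝ) (N := ⊤)
      (v := fun k (n : ℤ) => ‖symb L n‖ ^ k * ‖coef f n‖) ?_ (fun k _ => hs k) ?_
    · exact fun n => contDiff_const.mul (contDiff_exp_mul _)
    · intro k n x _
      rw [norm_iteratedFDeriv_eq_norm_iteratedDeriv, iteratedDeriv_const_mul_field,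
        iteratedDeriv_exp_mul, norm_mul, norm_mul, norm_pow]
      have h1 : ‖Complex.exp (symb L n * x)‖ = 1 := by
        rw [← fourier_eq_exp, fourier_apply, Circle.norm_coe]
      rw [h1]
      apply le_of_eq
      ring
  refine ⟨fun x => (Φ x).re, Complex.reCLM.contDiff.comp hΦ, fun x => ?_, ?_⟩
  · simp only [Φ, ← fourier_eq_exp, AddCircle.coe_add_period]
  · have h0 : Summable fun n => ‖coef f n‖ := by simpa using hs 0
    filter_upwards [ae_coe_of_ae (ae_hasSum_fourier h0)] with x hx
    simp only [fourier_eq_exp] at hx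
    simp only [Φ, hx.tsum_eq, Complex.ofReal_re]

end

section

variable {L : ℝ} [hL : Fact (0 < L)]

/-! ### The periodic Hilbert transform as a Fourier multiplier -/

/-- The factor by which the truncated Hilbert transform multiplies the `n`-th Fourier coefficient. -/
def truncMult (L : ℝ) (n : ℤ) (ε : ℝ) : ℂ :=
  (1 / L : ℝ) * ∫ s in ε..(L - ε), Complex.exp (-symb L n * s) * Real.cot (Real.pi / L * s)

/-- The mean of `exp (-2πins/L)` over the circle without the `ε`-neighbourhood of `0`. -/
def truncMean (L : ℝ) (n : ℤ) (ε : ℝ) : ℂ :=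
  (1 / L : ℝ) * ∫ s in ε..(L - ε), Complex.exp (-symb L n * s)

theorem sin_pos_of_mem_trunc {ε s : ℝ} (hε : 0 < ε) (hs : s ∈ Icc ε (L - ε)) :
    0 < Real.sin (Real.pi / L * s) := by
  have hL' := hL.out
  have hpi := Real.pi_pos
  apply Real.sin_pos_of_pos_of_lt_pi
  · have := hs.1
    have : 0 < s := by linarith
    positivity
  · have : s < L := by linarith [hs.2]
    calc Real.pi / L * s < Real.pi / L * L := by gcongr
      _ = Real.pi := by field_simp

theorem continuousOn_cot_trunc {ε : ℝ} (hε : 0 < ε) :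
    ContinuousOn (fun s : ℝ => Real.cot (Real.pi / L * s)) (Icc ε (L - ε)) := by
  simp only [Real.cot_eq_cos_div_sin]
  apply ContinuousOn.div
  · fun_prop
  · fun_prop
  · exact fun s hs => (sin_pos_of_mem_trunc hε hs).ne'

theorem truncMult_neg (n : ℤ) (ε : ℝ) : truncMult L (-n) ε = -truncMult L n ε := by
  have hL' := hL.out
  rw [truncMult, truncMult, ← mul_neg, ← intervalIntegral.integral_neg]
  congr 1
  have h := intervalIntegral.integral_comp_sub_left (a := ε) (b := L - ε)
    (fun s : ℝ => Complex.exp (-symb L (-n) * s) * (Real.cot (Real.pi / L * s) : ℂ)) L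
  rw [sub_sub_cancel] at h
  rw [← h]
  congr 1
  ext s
  have h1 : Real.cot (Real.pi / L * (L - s)) = -Real.cot (Real.pi / L * s) := by
    rw [mul_sub, div_mul_cancel₀ _ hL'.ne', Real.cot_eq_cos_div_sin, Real.cot_eq_cos_div_sin,
      Real.sin_pi_sub, Real.cos_pi_sub, neg_div]
  have h2 : Complex.exp (-symb L (-n) * ((L - s : ℝ) : ℂ)) = Complex.exp (-symb L n * s) := by
    rw [← symb_neg, ← fourier_eq_exp, ← symb_neg, ← fourier_eq_exp, AddCircle.coe_sub,
      AddCircle.coe_period, zero_sub, neg_neg, fourier_apply, fourier_apply, smul_neg, neg_smul]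
  rw [h1, h2]
  push_cast
  ring

theorem truncMult_zero (ε : ℝ) : truncMult L 0 ε = 0 := by
  have := truncMult_neg (L := L) 0 ε
  rw [neg_zero] at this
  exact self_eq_neg.1 this

/-- The recursion `e^{-2i(n+1)θ} cot θ - e^{-2inθ} cot θ = -i (e^{-2inθ} + e^{-2i(n+1)θ})`. -/
theorem exp_mul_cot_succ {ε s : ℝ} (hε : 0 < ε) (hs : s ∈ Icc ε (L - ε)) (n : ℤ) :
    Complex.exp (-symb L (n + 1) * s) * (Real.cot (Real.pi / L * s) : ℂ) =
      Complex.exp (-symb L n * s) * Real.cot (Real.pi / L * s) -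
      Complex.I * (Complex.exp (-symb L n * s) + Complex.exp (-symb L (n + 1) * s)) := by
  have hL' := hL.out
  have hLc : (L : ℂ) ≠ 0 := by exact_mod_cast hL'.ne'
  set θ : ℝ := Real.pi / L * s with hθ
  have hsin : Complex.sin θ ≠ 0 := by
    rw [← Complex.ofReal_sin]
    exact_mod_cast (sin_pos_of_mem_trunc hε hs).ne'
  have e1 : Complex.exp (-symb L n * s) =
      Complex.exp (-(2 * n + 1) * θ * Complex.I) * Complex.exp (θ * Complex.I) := by
    rw [← Complex.exp_add, symb, hθ]
    congr 1
    push_cast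
    field_simp
    ring
  have e2 : Complex.exp (-symb L (n + 1) * s) =
      Complex.exp (-(2 * n + 1) * θ * Complex.I) * Complex.exp ((-θ : ℂ) * Complex.I) := by
    rw [← Complex.exp_add, symb, hθ]
    congr 1
    push_cast
    field_simp
    ring
  rw [e1, e2, Complex.exp_mul_I (θ : ℂ), Complex.exp_mul_I (-θ : ℂ), Complex.cos_neg,
    Complex.sin_neg, Real.cot_eq_cos_div_sin]
  generalize Complex.exp (-(2 * n + 1) * θ * Complex.I) = X
  push_cast
  field_simp
  ring

theorem truncMult_succ {ε : ℝ} (hε : 0 < ε) (hε' : ε ≤ L / 2) (n : ℤ) :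
    truncMult L (n + 1) ε =
      truncMult L n ε - Complex.I * (truncMean L n ε + truncMean L (n + 1) ε) := by
  have hle : ε ≤ L - ε := by linarith
  have i1 : ∀ n : ℤ, IntervalIntegrable (fun s : ℝ => Complex.exp (-symb L n * s)) volume ε (L - ε) :=
    fun n => (contDiff_exp_mul _).continuous.intervalIntegrable _ _
  have i2 : IntervalIntegrable (fun s : ℝ => Complex.exp (-symb L n * s) *
      (Real.cot (Real.pi / L * s) : ℂ)) volume ε (L - ε) := by
    apply ContinuousOn.intervalIntegrable
    rw [uIcc_of_le hle]
    exact (contDiff_exp_mul _).continuous.continuousOn.mul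
      (Complex.continuous_ofReal.comp_continuousOn (continuousOn_cot_trunc hε))
  have h : ∫ s in ε..(L - ε), Complex.exp (-symb L (n + 1) * s) * (Real.cot (Real.pi / L * s) : ℂ) =
      ∫ s in ε..(L - ε), (Complex.exp (-symb L n * s) * Real.cot (Real.pi / L * s) -
      Complex.I * (Complex.exp (-symb L n * s) + Complex.exp (-symb L (n + 1) * s))) := by
    apply intervalIntegral.integral_congr
    intro s hs
    rw [uIcc_of_le hle] at hs
    exact exp_mul_cot_succ hε hs n
  rw [truncMult, truncMult, truncMean, truncMean, h, intervalIntegral.integral_sub i2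
    (((i1 n).add (i1 (n + 1))).const_mul _), intervalIntegral.integral_const_mul,
    intervalIntegral.integral_add (i1 n) (i1 (n + 1))]
  ring

theorem truncMean_zero (ε : ℝ) : truncMean L 0 ε = ((1 - 2 * ε / L : ℝ) : ℂ) := by
  have hL' := hL.out
  have hLc : (L : ℂ) ≠ 0 := by exact_mod_cast hL'.ne'
  rw [truncMean, symb_zero]
  simp
  field_simp
  ring

theorem truncMean_of_ne {n : ℤ} (hn : n ≠ 0) (ε : ℝ) :
    truncMean L n ε = (1 / L : ℝ) * ((Complex.exp (symb L n * ε) - Complex.exp (-symb L n * ε)) /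
      (-symb L n)) := by
  rw [truncMean, integral_exp_mul_complex (neg_ne_zero.2 (symb_ne_zero hn))]
  congr 3
  rw [← symb_neg, ← fourier_eq_exp, AddCircle.coe_sub, AddCircle.coe_period, zero_sub,
    ← fourier_eq_exp, fourier_apply, fourier_apply, smul_neg, neg_smul, neg_neg]

theorem norm_truncMean_le {ε : ℝ} (hε : 0 < ε) (hε' : ε ≤ L / 2) (j : ℕ) :
    ‖truncMean L j ε‖ ≤ ((j : ℝ) + 1)⁻¹ := by
  have hL' := hL.out
  rcases Nat.eq_zero_or_pos j with rfl | hj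
  · have h1 : 0 ≤ 1 - 2 * ε / L := by
      rw [sub_nonneg, div_le_one hL']
      linarith
    have h2 : 0 ≤ 2 * ε / L := by positivity
    rw [Nat.cast_zero, truncMean_zero, Complex.norm_real, Real.norm_of_nonneg h1]
    simpa using h2
  · have hj' : (j : ℤ) ≠ 0 := by exact_mod_cast hj.ne'
    have h1 : ∀ n : ℤ, ‖Complex.exp (symb L n * ε)‖ = 1 := fun n => by
      rw [← fourier_eq_exp, fourier_apply, Circle.norm_coe]
    have hj1 : (1 : ℝ) ≤ j := by exact_mod_cast hj
    have hpi := Real.pi_gt_three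
    rw [truncMean_of_ne hj', norm_mul, norm_div, norm_neg, norm_symb, Complex.norm_real,
      Real.norm_of_nonneg (by positivity)]
    have h2 : ‖Complex.exp (symb L j * ε) - Complex.exp (-symb L j * ε)‖ ≤ 2 := by
      refine (norm_sub_le _ _).trans ?_
      rw [← symb_neg, h1, h1]
      norm_num
    calc 1 / L * (‖Complex.exp (symb L j * ε) - Complex.exp (-symb L j * ε)‖ /
          (2 * Real.pi / L * |((j : ℤ) : ℝ)|))
        ≤ 1 / L * (2 / (2 * Real.pi / L * |((j : ℤ) : ℝ)|)) := by gcongr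
      _ = (Real.pi * j)⁻¹ := by
        simp
        field_simp
      _ ≤ ((j : ℝ) + 1)⁻¹ := by
        gcongr
        nlinarith

/-- The truncated multipliers grow at most logarithmically, uniformly in the truncation. -/
theorem norm_truncMult_le {ε : ℝ} (hε : 0 < ε) (hε' : ε ≤ L / 2) (n : ℤ) :
    ‖truncMult L n ε‖ ≤ 2 * harmonic n.natAbs := by
  have key : ∀ n : ℕ, ‖truncMult L n ε‖ ≤ 2 * harmonic n := by
    intro n
    induction n with
    | zero => simp [truncMult_zero]
    | succ n ih =>
      push_cast
      rw [truncMult_succ hε hε', harmonic_succ]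
      push_cast
      have h1 := norm_truncMean_le hε hε' n
      have h2 := norm_truncMean_le hε hε' (n + 1)
      have h3 : (((n + 1 : ℕ) : ℝ) + 1)⁻¹ ≤ ((n : ℝ) + 1)⁻¹ := by
        push_cast
        gcongr
        linarith
      have h4 := norm_sub_le (truncMult L n ε) (Complex.I * (truncMean L n ε + truncMean L (n + 1) ε))
      rw [norm_mul, Complex.norm_I, one_mul] at h4
      have h5 := norm_add_le (truncMean L n ε) (truncMean L (n + 1) ε)
      push_cast at h2 h3
      linarith
  rcases Int.natAbs_eq n with h | h
  · conv_lhs => rw [h]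
    exact key n.natAbs
  · conv_lhs => rw [h, truncMult_neg, norm_neg]
    exact key n.natAbs

theorem tendsto_truncMean (n : ℤ) :
    Tendsto (truncMean L n) (𝓝[>] 0) (𝓝 (if n = 0 then 1 else 0)) := by
  rcases eq_or_ne n 0 with rfl | hn
  · rw [if_pos rfl]
    have : Continuous fun ε : ℝ => ((1 - 2 * ε / L : ℝ) : ℂ) := by fun_prop
    have h := this.tendsto 0
    simp only [mul_zero, zero_div, sub_zero, Complex.ofReal_one] at h
    refine (h.mono_left nhdsWithin_le_nhds).congr fun ε => (truncMean_zero ε).symm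
  · rw [if_neg hn]
    have : Continuous fun ε : ℝ => ((1 / L : ℝ) : ℂ) *
      ((Complex.exp (symb L n * ε) - Complex.exp (-symb L n * ε)) / (-symb L n)) := by fun_prop
    have h := this.tendsto 0
    simp only [Complex.ofReal_zero, mul_zero, sub_self, zero_div] at h
    refine (h.mono_left nhdsWithin_le_nhds).congr fun ε => (truncMean_of_ne hn ε).symm

/-- The Fourier symbol `-i sgn n` of the periodic Hilbert transform. -/
def hilbertSymb (n : ℤ) : ℂ := -Complex.I * n.sign

theorem norm_hilbertSymb_le (n : ℤ) : ‖hilbertSymb n‖ ≤ 1 := by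
  rw [hilbertSymb, norm_mul, norm_neg, Complex.norm_I, one_mul, Complex.norm_intCast]
  rcases lt_trichotomy n 0 with h | h | h
  · simp [Int.sign_eq_neg_one_of_neg h]
  · simp [h]
  · simp [Int.sign_eq_one_of_pos h]

theorem hilbertSymb_neg (n : ℤ) : hilbertSymb (-n) = conj (hilbertSymb n) := by
  simp [hilbertSymb]

theorem tendsto_truncMult (n : ℤ) :
    Tendsto (truncMult L n) (𝓝[>] 0) (𝓝 (hilbertSymb n)) := by
  have hL' := hL.out
  have hev : ∀ᶠ ε in 𝓝[>] (0 : ℝ), 0 < ε ∧ ε ≤ L / 2 := by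
    filter_upwards [self_mem_nhdsWithin, Ioc_mem_nhdsGT (show (0 : ℝ) < L / 2 by positivity)]
      with ε h1 h2 using ⟨h1, h2.2⟩
  have h0 : Tendsto (truncMult L 0) (𝓝[>] 0) (𝓝 0) := by
    simp only [show truncMult L 0 = fun _ => 0 from funext truncMult_zero]
    exact tendsto_const_nhds
  have key : ∀ n : ℕ, Tendsto (truncMult L (n + 1 : ℕ)) (𝓝[>] 0) (𝓝 (-Complex.I)) := by
    intro n
    induction n with
    | zero =>
      have := h0.sub (((tendsto_truncMean (L := L) 0).add (tendsto_truncMean (L := L) (0 + 1))).const_mul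
        Complex.I)
      simp only [reduceIte, zero_add, one_ne_zero, add_zero, mul_one, zero_sub] at this
      refine this.congr' ?_
      filter_upwards [hev] with ε hε
      have := truncMult_succ hε.1 hε.2 0
      simp only [zero_add] at this
      rw [← this]
      simp
    | succ n ih =>
      have := ih.sub (((tendsto_truncMean (L := L) (n + 1 : ℕ)).add
        (tendsto_truncMean (L := L) ((n + 1 : ℕ) + 1))).const_mul Complex.I)
      rw [if_neg (by positivity), if_neg (by positivity), add_zero, mul_zero, sub_zero] at this
      refine this.congr' ?_
      filter_upwards [hev] with ε hε
      rw [← truncMult_succ hε.1 hε.2]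
      push_cast
      rfl
  rcases lt_trichotomy n 0 with h | h | h
  · obtain ⟨m, hm⟩ : ∃ m : ℕ, n = -((m + 1 : ℕ) : ℤ) := ⟨n.natAbs - 1, by omega⟩
    have h2 := (key m).neg
    rw [hilbertSymb, Int.sign_eq_neg_one_of_neg h, hm]
    simp only [show truncMult L (-((m + 1 : ℕ) : ℤ)) = fun ε => -truncMult L ((m + 1 : ℕ) : ℤ) ε from
      funext (truncMult_neg _)]
    simpa using h2
  · rw [h]; simpa [hilbertSymb] using h0
  · obtain ⟨m, hm⟩ : ∃ m : ℕ, n = ((m + 1 : ℕ) : ℤ) := ⟨n.natAbs - 1, by omega⟩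
    rw [hilbertSymb, Int.sign_eq_one_of_pos h, hm]
    simpa using key m

/-- The truncated Hilbert transform of a function with absolutely convergent Fourier series. -/
theorem hasSum_hilbertTrunc {w : L2S L} (hw : Summable fun n => ‖coef w n‖) (z : AddCircle L)
    {ε : ℝ} (hε : 0 < ε) (hε' : ε ≤ L / 2) :
    HasSum (fun n => coef w n * fourier n z * truncMult L n ε) (hilbertTrunc w z ε : ℂ) := by
  have hle : ε ≤ L - ε := by linarith
  obtain ⟨C, hC⟩ := isCompact_Icc.exists_bound_of_continuousOn (continuousOn_cot_trunc (L := L) hε)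
  have hae : ∀ᵐ s : ℝ, HasSum (fun n => coef w n * fourier n (z - (s : AddCircle L)))
      (w (z - (s : AddCircle L)) : ℂ) :=
    ae_coe_of_ae ((Measure.measurePreserving_sub_left volume z).quasiMeasurePreserving.ae
      (ae_hasSum_fourier hw))
  have hf : ∀ (n : ℤ) (s : ℝ), fourier n (z - (s : AddCircle L)) =
      fourier n z * Complex.exp (-symb L n * s) := by
    intro n s
    rw [← symb_neg, ← fourier_eq_exp, fourier_apply, fourier_apply, fourier_apply, smul_sub,
      sub_eq_add_neg, AddCircle.toCircle_add, neg_smul]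
    simp
  have hn : ∀ (n : ℤ) (s : ℝ), ‖Complex.exp (-symb L n * s)‖ = 1 := fun n s => by
    rw [← symb_neg, ← fourier_eq_exp, fourier_apply, Circle.norm_coe]
  have h := intervalIntegral.hasSum_integral_of_dominated_convergence (μ := volume)
    (a := ε) (b := L - ε)
    (F := fun (n : ℤ) (s : ℝ) => coef w n * fourier n z *
      (Complex.exp (-symb L n * s) * (Real.cot (Real.pi / L * s) : ℂ)))
    (f := fun s : ℝ => ((w (z - (s : AddCircle L)) * Real.cot (Real.pi / L * s) : ℝ) : ℂ))
    (fun n _ => ‖coef w n‖ * C) ?_ ?_ ?_ ?_ ?_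
  · have h2 := h.mul_left ((1 / L : ℝ) : ℂ)
    rw [intervalIntegral.integral_ofReal, ← Complex.ofReal_mul] at h2
    refine h2.congr_fun fun n => ?_
    rw [intervalIntegral.integral_const_mul, truncMult]
    ring
  · intro n
    rw [uIoc_of_le hle]
    apply AEStronglyMeasurable.const_mul
    apply ContinuousOn.aestronglyMeasurable _ measurableSet_Ioc
    exact ((contDiff_exp_mul _).continuous.continuousOn.mul
      (Complex.continuous_ofReal.comp_continuousOn (continuousOn_cot_trunc hε))).mono
      Ioc_subset_Icc_self
  · intro n
    filter_upwards with s hs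
    rw [uIoc_of_le hle] at hs
    rw [norm_mul, norm_mul, norm_mul, hn, fourier_apply, Circle.norm_coe, mul_one, one_mul,
      Complex.norm_real]
    gcongr
    exact hC s (Ioc_subset_Icc_self hs)
  · filter_upwards with s _
    exact hw.mul_right C
  · exact intervalIntegrable_const
  · filter_upwards [hae] with s hs _
    have := hs.mul_right (Real.cot (Real.pi / L * s) : ℂ)
    push_cast
    push_cast at this
    refine this.congr_fun fun n => ?_
    rw [hf]
    ring

theorem summable_coef_mul_harmonic {w : L2S L} (hw : w ∈ sobolevH L 1) :
    Summable fun n : ℤ => ‖coef w n‖ * (2 * harmonic n.natAbs) := by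
  rw [mem_sobolevH_iff] at hw
  have h1 := (Real.summable_abs_int_rpow (b := 3 / 2) (by norm_num)).mul_left 100
  refine (hw.add h1).of_nonneg_of_le (fun n => ?_) fun n => ?_
  · have : (0 : ℚ) ≤ harmonic n.natAbs := Finset.sum_nonneg fun _ _ => by positivity
    have : (0 : ℝ) ≤ harmonic n.natAbs := by exact_mod_cast this
    positivity
  rcases eq_or_ne n 0 with rfl | hn
  · simp
  have hn1 : (1 : ℝ) ≤ |(n : ℝ)| := by exact_mod_cast Int.one_le_abs hn
  have hn0 : (0 : ℝ) < |(n : ℝ)| := by linarith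
  have hcast : ((n.natAbs : ℕ) : ℝ) = |(n : ℝ)| := by
    rw [Nat.cast_natAbs]; push_cast; rfl
  have h2 := harmonic_le_one_add_log n.natAbs
  rw [hcast] at h2
  have h3 := Real.log_le_rpow_div hn0.le (show (0 : ℝ) < 1 / 4 by norm_num)
  have h4 : (1 : ℝ) ≤ |(n : ℝ)| ^ (1 / 4 : ℝ) := Real.one_le_rpow hn1 (by norm_num)
  have h5 : 2 * (harmonic n.natAbs : ℝ) ≤ 10 * |(n : ℝ)| ^ (1 / 4 : ℝ) := by linarith
  have h6 : (|(n : ℝ)| ^ (-(3 / 4) : ℝ)) ^ 2 = |(n : ℝ)| ^ (-(3 / 2) : ℝ) := by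
    rw [← Real.rpow_natCast, ← Real.rpow_mul hn0.le]
    norm_num
  have h7 : |(n : ℝ)| ^ (1 / 4 : ℝ) = |(n : ℝ)| * |(n : ℝ)| ^ (-(3 / 4) : ℝ) := by
    rw [← Real.rpow_one_add' hn0.le (by norm_num)]
    norm_num
  calc ‖coef w n‖ * (2 * harmonic n.natAbs) ≤ ‖coef w n‖ * (10 * |(n : ℝ)| ^ (1 / 4 : ℝ)) := by
        gcongr
    _ = (|(n : ℝ)| ^ 1 * ‖coef w n‖) * (10 * |(n : ℝ)| ^ (-(3 / 4) : ℝ)) := by rw [h7]; ring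
    _ ≤ (|(n : ℝ)| ^ 1 * ‖coef w n‖) ^ 2 + (10 * |(n : ℝ)| ^ (-(3 / 4) : ℝ)) ^ 2 := by
        have := two_mul_le_add_sq (|(n : ℝ)| ^ 1 * ‖coef w n‖) (10 * |(n : ℝ)| ^ (-(3 / 4) : ℝ))
        have h0 : 0 ≤ (|(n : ℝ)| ^ 1 * ‖coef w n‖) * (10 * |(n : ℝ)| ^ (-(3 / 4) : ℝ)) := by
          positivity
        linarith
    _ = _ := by rw [← h6]; ring

/-- On `H¹` the principal value Hilbert transform is the Fourier multiplier `-i sgn n`. -/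
theorem coef_of_isHilbertTransform {w g : L2S L} (hw : w ∈ sobolevH L 1)
    (h : IsHilbertTransform w g) (n : ℤ) : coef g n = hilbertSymb n * coef w n := by
  have hL' := hL.out
  have hsum : Summable fun n => ‖coef w n‖ := by
    simpa using summable_of_mem_sobolevH (k := 0) hw
  have hle : ∀ n, ‖hilbertSymb n * coef w n‖ ≤ ‖coef w n‖ := fun n => by
    rw [norm_mul]
    exact mul_le_of_le_one_left (norm_nonneg _) (norm_hilbertSymb_le n)
  obtain ⟨g', hg'⟩ := exists_coef_eq (L := L) (c := fun n => hilbertSymb n * coef w n)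
    ((hasSum_norm_coef_sq w).summable.of_nonneg_of_le (fun _ => by positivity)
      fun n => by gcongr; exact hle n)
    (fun n => by rw [hilbertSymb_neg, coef_neg_index, map_mul])
  have hsum' : Summable fun n => ‖coef g' n‖ := by
    simp only [hg']
    exact hsum.of_nonneg_of_le (fun _ => norm_nonneg _) hle
  suffices g = g' by rw [this, hg']
  apply Lp.ext
  filter_upwards [h, ae_hasSum_fourier hsum'] with z hz hz'
  have hev : ∀ᶠ ε in 𝓝[>] (0 : ℝ), 0 < ε ∧ ε ≤ L / 2 := by
    filter_upwards [self_mem_nhdsWithin, Ioc_mem_nhdsGT (show (0 : ℝ) < L / 2 by positivity)]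
      with ε h1 h2 using ⟨h1, h2.2⟩
  have hlim : Tendsto (fun ε => ∑' n, coef w n * fourier n z * truncMult L n ε) (𝓝[>] 0)
      (𝓝 (∑' n, coef w n * fourier n z * hilbertSymb n)) := by
    refine tendsto_tsum_of_dominated_convergence (summable_coef_mul_harmonic hw)
      (fun n => (tendsto_truncMult n).const_mul _) ?_
    filter_upwards [hev] with ε hε n
    rw [norm_mul, norm_mul, fourier_apply, Circle.norm_coe, mul_one]
    gcongr
    exact norm_truncMult_le hε.1 hε.2 n
  have h1 : Tendsto (fun ε => (hilbertTrunc w z ε : ℂ)) (𝓝[>] 0) (𝓝 (g z : ℂ)) :=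
    (Complex.continuous_ofReal.tendsto _).comp hz
  have h2 : Tendsto (fun ε => (hilbertTrunc w z ε : ℂ)) (𝓝[>] 0)
      (𝓝 (∑' n, coef w n * fourier n z * hilbertSymb n)) := by
    refine hlim.congr' ?_
    filter_upwards [hev] with ε hε
    exact (hasSum_hilbertTrunc hsum z hε.1 hε.2).tsum_eq
  have h3 := tendsto_nhds_unique h1 h2
  rw [← Complex.ofReal_inj, h3, ← hz'.tsum_eq]
  congr 1
  ext n
  rw [hg']
  ring

end

section

/-! ### Truncated weights -/

/-- The weight `min (|k|, N) ^ m`: the symbol of `|∂_z| ^ m`, made bounded by a cutoff at `N`. -/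
def weight (m N : ℕ) (k : ℤ) : ℝ := (min |(k : ℝ)| N) ^ m

theorem weight_nonneg (m N : ℕ) (k : ℤ) : 0 ≤ weight m N k := by
  unfold weight; positivity

theorem weight_le (m N : ℕ) (k : ℤ) : weight m N k ≤ N ^ m := by
  unfold weight
  gcongr
  exact min_le_right _ _

theorem weight_le_abs (m N : ℕ) (k : ℤ) : weight m N k ≤ |(k : ℝ)| ^ m := by
  unfold weight
  gcongr
  exact min_le_left _ _

theorem weight_neg (m N : ℕ) (k : ℤ) : weight m N (-k) = weight m N k := by
  simp [weight]

theorem weight_eq {m N : ℕ} {k : ℤ} (h : k.natAbs ≤ N) : weight m N k = |(k : ℝ)| ^ m := by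
  have : |(k : ℝ)| ≤ N := by
    have h1 : ((k.natAbs : ℕ) : ℝ) ≤ N := by exact_mod_cast h
    rwa [Nat.cast_natAbs, Int.cast_abs] at h1
  rw [weight, min_eq_left this]

theorem pow_sub_pow_le {x y : ℝ} (hx : 0 ≤ x) (hxy : x ≤ y) (m : ℕ) :
    y ^ (m + 1) - x ^ (m + 1) ≤ (m + 1) * ((y - x) * y ^ m) := by
  induction m with
  | zero => simp
  | succ m ih =>
    have h1 : x ^ (m + 1) ≤ y ^ (m + 1) := by gcongr
    have h2 : 0 ≤ y - x := by linarith
    have hy : 0 ≤ y := hx.trans hxy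
    have h3 := mul_le_mul_of_nonneg_left ih hy
    have h4 := mul_le_mul_of_nonneg_left h1 h2
    have e : y ^ (m + 1 + 1) - x ^ (m + 1 + 1) =
      y * (y ^ (m + 1) - x ^ (m + 1)) + (y - x) * x ^ (m + 1) := by ring
    rw [e]
    push_cast
    calc _ ≤ y * ((m + 1) * ((y - x) * y ^ m)) + (y - x) * y ^ (m + 1) := add_le_add h3 h4
      _ = _ := by ring

theorem min_le_min_add_min {a b d M : ℝ} (hb : 0 ≤ b) (hd : 0 ≤ d) (hM : 0 ≤ M) (h : a ≤ b + d) :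
    min a M ≤ min b M + min d M := by
  rcases le_total b M with h1 | h1 <;> rcases le_total d M with h2 | h2 <;>
    rcases le_total a M with h3 | h3 <;>
    simp only [min_eq_left, min_eq_right, h1, h2, h3] <;> linarith

/-- The commutator estimate for the truncated weights, in terms of the three moduli. -/
theorem abs_min_pow_sub_mul_le {a b d M : ℝ} (ha : 0 ≤ a) (hb : 0 ≤ b) (hd : 0 ≤ d) (hM : 0 ≤ M)
    (h1 : a ≤ b + d) (h2 : b ≤ a + d) (m : ℕ) :
    |min a M ^ (m + 1) - min b M ^ (m + 1)| * b ≤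
      ((m + 1) * 2 ^ (m + 1)) * (d * min b M ^ (m + 1) + min d M ^ (m + 1) * b) := by
  have hy : 0 ≤ min b M := le_min hb hM
  have hx : 0 ≤ min a M := le_min ha hM
  have hz : 0 ≤ min d M := le_min hd hM
  have h2m : (1 : ℝ) ≤ 2 ^ m := one_le_pow₀ (by norm_num)
  have hm : (0 : ℝ) ≤ m := Nat.cast_nonneg m
  rcases le_total a b with hab | hab
  · have hxy : min a M ≤ min b M := min_le_min_right M hab
    have h3 : (min b M - min a M) * b ≤ d * min b M := by
      rcases le_total b M with hbM | hbM
      · rw [min_eq_left hbM, min_eq_left (hab.trans hbM)]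
        nlinarith
      · rw [min_eq_right hbM]
        rcases le_total a M with haM | haM
        · rw [min_eq_left haM]
          nlinarith
        · rw [min_eq_right haM]
          nlinarith
    rw [abs_sub_comm, abs_of_nonneg (sub_nonneg.2 (by gcongr))]
    calc _ ≤ (m + 1) * ((min b M - min a M) * min b M ^ m) * b := by
          gcongr; exact pow_sub_pow_le hx hxy m
      _ = (m + 1) * min b M ^ m * ((min b M - min a M) * b) := by ring
      _ ≤ (m + 1) * min b M ^ m * (d * min b M) := by gcongr
      _ = ((m + 1) * 1) * (d * min b M ^ (m + 1) + 0) := by ring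
      _ ≤ _ := by
        gcongr
        · exact one_le_pow₀ (by norm_num)
        · positivity
  · have hyx : min b M ≤ min a M := min_le_min_right M hab
    rw [abs_of_nonneg (sub_nonneg.2 (by gcongr))]
    rcases le_total d b with hdb | hdb
    · have h4 : min a M ≤ 2 * min b M := by
        have := min_le_min_add_min hb hb hM (h1.trans (add_le_add_right hdb b))
        linarith
      have h3 : (min a M - min b M) * b ≤ d * min b M := by
        rcases le_total b M with hbM | hbM
        · rw [min_eq_left hbM]
          have := min_le_left a M
          nlinarith
        · rw [min_eq_right hbM, min_eq_right (hbM.trans hab)]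
          nlinarith
      calc _ ≤ (m + 1) * ((min a M - min b M) * min a M ^ m) * b := by
            gcongr; exact pow_sub_pow_le hy hyx m
        _ = (m + 1) * min a M ^ m * ((min a M - min b M) * b) := by ring
        _ ≤ (m + 1) * (2 * min b M) ^ m * (d * min b M) := by gcongr
        _ = ((m + 1) * 2 ^ m) * (d * min b M ^ (m + 1) + 0) := by ring
        _ ≤ _ := by
          gcongr
          · norm_num
          · omega
          · positivity
    · have h4 : min a M ≤ 2 * min d M := by
        have := min_le_min_add_min hd hd hM (h1.trans (add_le_add_left hdb d))
        linarith
      calc _ ≤ min a M ^ (m + 1) * b := by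
            gcongr
            have : 0 ≤ min b M ^ (m + 1) := by positivity
            linarith
        _ ≤ (2 * min d M) ^ (m + 1) * b := by gcongr
        _ = (1 * 2 ^ (m + 1)) * (0 + min d M ^ (m + 1) * b) := by ring
        _ ≤ _ := by
          gcongr
          · linarith
          · positivity

theorem abs_weight_sub_mul_le (m N : ℕ) (k l : ℤ) :
    |weight (m + 1) N k - weight (m + 1) N l| * |(l : ℝ)| ≤ ((m + 1) * 2 ^ (m + 1)) *
      (|((k - l : ℤ) : ℝ)| * weight (m + 1) N l + weight (m + 1) N (k - l) * |(l : ℝ)|) := by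
  have h1 : |(k : ℝ)| ≤ |(l : ℝ)| + |((k - l : ℤ) : ℝ)| := by
    have := abs_add_le (l : ℝ) ((k - l : ℤ) : ℝ)
    simpa using this
  have h2 : |(l : ℝ)| ≤ |(k : ℝ)| + |((k - l : ℤ) : ℝ)| := by
    have := abs_sub (k : ℝ) ((k - l : ℤ) : ℝ)
    simpa using this
  exact abs_min_pow_sub_mul_le (abs_nonneg _) (abs_nonneg _) (abs_nonneg _) (Nat.cast_nonneg N)
    h1 h2 m

theorem weight_le_add (m N : ℕ) (k l : ℤ) :
    weight m N k ≤ 2 ^ m * (weight m N (k - l) + weight m N l) := by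
  have h1 : |(k : ℝ)| ≤ |(l : ℝ)| + |((k - l : ℤ) : ℝ)| := by
    have := abs_add_le (l : ℝ) ((k - l : ℤ) : ℝ)
    simpa using this
  have h := min_le_min_add_min (abs_nonneg _) (abs_nonneg _) (Nat.cast_nonneg N) h1
  have hy : 0 ≤ min |(l : ℝ)| (N : ℝ) := by positivity
  have hz : 0 ≤ min |((k - l : ℤ) : ℝ)| (N : ℝ) := by positivity
  have hx : 0 ≤ min |(k : ℝ)| (N : ℝ) := by positivity
  unfold weight
  rcases le_total (min |((k - l : ℤ) : ℝ)| (N : ℝ)) (min |(l : ℝ)| (N : ℝ)) with h3 | h3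
  · calc _ ≤ (2 * min |(l : ℝ)| (N : ℝ)) ^ m := by gcongr; linarith
      _ = 2 ^ m * (0 + min |(l : ℝ)| (N : ℝ) ^ m) := by ring
      _ ≤ _ := by gcongr; positivity
  · calc _ ≤ (2 * min |((k - l : ℤ) : ℝ)| (N : ℝ)) ^ m := by gcongr; linarith
      _ = 2 ^ m * (min |((k - l : ℤ) : ℝ)| (N : ℝ) ^ m + 0) := by ring
      _ ≤ _ := by gcongr; positivity

/-! ### Sequence norms and Young's inequality -/

/-- The `ℓ¹` norm of a sequence, possibly infinite. -/
def l1 (f : ℤ → ℂ) : ℝ≥0∞ := ∑' n, ‖f n‖ₑ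

/-- The `ℓ²` norm of a sequence, possibly infinite. -/
def l2 (f : ℤ → ℂ) : ℝ≥0∞ := (∑' n, ‖f n‖ₑ ^ 2) ^ (1 / 2 : ℝ)

theorem l2_sq (f : ℤ → ℂ) : l2 f ^ 2 = ∑' n, ‖f n‖ₑ ^ 2 := by
  rw [l2, ← ENNReal.rpow_natCast, ← ENNReal.rpow_mul]
  norm_num

theorem l2_mono {f g : ℤ → ℂ} (h : ∀ n, ‖f n‖ₑ ≤ ‖g n‖ₑ) : l2 f ≤ l2 g := by
  unfold l2
  gcongr with n
  exact h n

theorem tsum_mul_le_l2_mul_l2 (f g : ℤ → ℂ) : ∑' n, ‖f n‖ₑ * ‖g n‖ₑ ≤ l2 f * l2 g := by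
  have h := ENNReal.lintegral_mul_le_Lp_mul_Lq (Measure.count : Measure ℤ)
    (Real.HolderConjugate.two_two) (f := fun n => ‖f n‖ₑ) (g := fun n => ‖g n‖ₑ)
    (measurable_of_countable _).aemeasurable (measurable_of_countable _).aemeasurable
  simp only [lintegral_count, Pi.mul_apply] at h
  simpa only [l2, ← ENNReal.rpow_two] using h

theorem l2_comp_equiv (f : ℤ → ℂ) (e : ℤ ≃ ℤ) : l2 (fun n => f (e n)) = l2 f := by
  unfold l2
  rw [e.tsum_eq (fun n => ‖f n‖ₑ ^ 2)]

/-- Young's inequality in trilinear form. -/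
theorem tsum_tsum_le_l1_left (x y z : ℤ → ℂ) :
    ∑' k, ∑' n, ‖y k‖ₑ * (‖x (k - n)‖ₑ * ‖z n‖ₑ) ≤ l1 x * (l2 y * l2 z) := by
  calc ∑' k, ∑' n, ‖y k‖ₑ * (‖x (k - n)‖ₑ * ‖z n‖ₑ)
      = ∑' k, ∑' j, ‖y k‖ₑ * (‖x j‖ₑ * ‖z (k - j)‖ₑ) := by
        congr 1
        ext k
        rw [← (Equiv.subLeft k).tsum_eq]
        simp
    _ = ∑' j, ‖x j‖ₑ * ∑' k, ‖y k‖ₑ * ‖z (k - j)‖ₑ := by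
        rw [ENNReal.tsum_comm]
        congr 1
        ext j
        rw [← ENNReal.tsum_mul_left]
        congr 1
        ext k
        ring
    _ ≤ ∑' j, ‖x j‖ₑ * (l2 y * l2 z) := by
        gcongr with j
        rw [← l2_comp_equiv z (Equiv.subRight j)]
        exact tsum_mul_le_l2_mul_l2 y (fun k => z (k - j))
    _ = l1 x * (l2 y * l2 z) := ENNReal.tsum_mul_right

theorem tsum_tsum_le_l1_right (x y z : ℤ → ℂ) :
    ∑' k, ∑' n, ‖y k‖ₑ * (‖z (k - n)‖ₑ * ‖x n‖ₑ) ≤ l1 x * (l2 y * l2 z) := by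
  refine le_trans (le_of_eq ?_) (tsum_tsum_le_l1_left x y z)
  congr 1
  ext k
  rw [← (Equiv.subLeft k).tsum_eq]
  simp [mul_comm]

end

section

/-! ### Energy estimates for the transport term -/

theorem summable_of_tsum_enorm_ne_top {ι : Type*} {f : ι → ℂ} (h : ∑' i, ‖f i‖ₑ ≠ ⊤) :
    Summable f :=
  .of_nnnorm (ENNReal.tsum_coe_ne_top_iff_summable.1 h)

theorem summable_conv {f g : ℤ → ℂ} (hf : l1 f ≠ ⊤) (hg : l2 g ≠ ⊤) (k : ℤ) :
    Summable fun n => f (k - n) * g n := by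
  have hg' : ∀ n, ‖g n‖ₑ ≤ l2 g := fun n => by
    have : ‖g n‖ₑ ^ 2 ≤ l2 g ^ 2 := by
      rw [l2_sq]; exact ENNReal.le_tsum (f := fun n => ‖g n‖ₑ ^ 2) n
    exact (ENNReal.pow_le_pow_left_iff (by norm_num)).1 this
  apply summable_of_tsum_enorm_ne_top
  refine ne_top_of_le_ne_top (ENNReal.mul_ne_top hf hg) ?_
  calc ∑' n, ‖f (k - n) * g n‖ₑ ≤ ∑' n, ‖f (k - n)‖ₑ * l2 g := by
        gcongr with n
        rw [enorm_mul]
        gcongr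
        exact hg' n
    _ = l1 f * l2 g := by
        rw [ENNReal.tsum_mul_right, l1, ← (Equiv.subLeft k).tsum_eq (fun n => ‖f n‖ₑ)]
        rfl

theorem enorm_weight_mul {W : ℤ → ℝ} (x : ℂ) (k : ℤ) (hW : 0 ≤ W k) :
    ‖(W k : ℂ) * x‖ₑ = ENNReal.ofReal (W k) * ‖x‖ₑ := by
  rw [enorm_mul, ← ofReal_norm (W k : ℂ), Complex.norm_real, Real.norm_of_nonneg hW]

/-- The transport term `v f_z`, paired with `f` in a weighted `ℓ²` space, loses no derivative: up
to a commutator with the weight, the operator `v ∂_z` is antisymmetric modulo `v_z`. Here `c`, `f`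
are the Fourier coefficients of `v`, `f`. -/
theorem enorm_re_transport_le {L : ℝ} {W : ℤ → ℝ} {A B : ℝ} (hA : 0 ≤ A) (hW0 : ∀ n, 0 ≤ W n)
    (hWB : ∀ n, W n ≤ B)
    (hcomm : ∀ k n, |W k - W n| * ‖symb L n‖ ≤
      A * (‖symb L (k - n)‖ * W n + W (k - n) * ‖symb L n‖))
    {c f : ℤ → ℂ} (hc : ∀ n, c (-n) = conj (c n)) (hc1 : l1 c ≠ ⊤) (hf : l2 f ≠ ⊤)
    (hf' : l2 (fun n => symb L n * f n) ≠ ⊤) :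
    ‖(∑' k, (W k : ℂ) ^ 2 * (conj (f k) * ∑' n, c (k - n) * (symb L n * f n))).re‖ₑ ≤
      (1 + ENNReal.ofReal A) * (l1 (fun n => symb L n * c n) * l2 (fun n => W n * f n) ^ 2 +
        l1 (fun n => W n * c n) * (l2 (fun n => W n * f n) * l2 (fun n => symb L n * f n))) := by
  set g : ℤ → ℂ := fun n => W n * f n with hg
  let F : ℤ × ℤ → ℂ := fun q =>
    (W q.1 : ℂ) ^ 2 * (conj (f q.1) * (c (q.1 - q.2) * (symb L q.2 * f q.2)))
  let G : ℤ × ℤ → ℂ := fun q => conj (g q.1) * (c (q.1 - q.2) * (symb L q.2 * g q.2))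
  let R : ℤ × ℤ → ℂ := fun q =>
    conj (g q.1) * (c (q.1 - q.2) * (((W q.1 - W q.2 : ℝ) : ℂ) * symb L q.2 * f q.2))
  have hFGR : ∀ q, F q = G q + R q := by
    intro q
    simp only [F, G, R, hg, map_mul, Complex.conj_ofReal, Complex.ofReal_sub]
    ring
  -- both double series are dominated by one of Young's type
  have hB : 0 ≤ B := (hW0 0).trans (hWB 0)
  have hdom : ∑' k, ∑' n, ENNReal.ofReal (B ^ 2) * (‖f k‖ₑ * (‖c (k - n)‖ₑ * ‖symb L n * f n‖ₑ))
      ≠ ⊤ := by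
    simp only [ENNReal.tsum_mul_left]
    refine ENNReal.mul_ne_top ENNReal.ofReal_ne_top (ne_top_of_le_ne_top
      (ENNReal.mul_ne_top hc1 (ENNReal.mul_ne_top hf hf')) ?_)
    simpa only [ENNReal.tsum_mul_left] using tsum_tsum_le_l1_left c f (fun n => symb L n * f n)
  have hF : Summable F := by
    apply summable_of_tsum_enorm_ne_top
    rw [ENNReal.tsum_prod']
    refine ne_top_of_le_ne_top hdom ?_
    gcongr with k n
    simp only [F]
    rw [pow_two, mul_assoc, enorm_weight_mul _ _ (hW0 k), enorm_weight_mul _ _ (hW0 k), enorm_mul,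
      enorm_mul (c _), RCLike.enorm_conj, ← mul_assoc, ENNReal.ofReal_pow hB, pow_two]
    gcongr <;> exact hWB k
  have hG : Summable G := by
    apply summable_of_tsum_enorm_ne_top
    rw [ENNReal.tsum_prod']
    refine ne_top_of_le_ne_top hdom ?_
    gcongr with k n
    simp only [G, hg]
    rw [show symb L n * ((W n : ℂ) * f n) = W n * (symb L n * f n) by ring, enorm_mul, enorm_mul (c _),
      RCLike.enorm_conj, enorm_weight_mul _ _ (hW0 k), enorm_weight_mul _ _ (hW0 n),
      ENNReal.ofReal_pow hB, pow_two]
    calc _ = ENNReal.ofReal (W k) * ENNReal.ofReal (W n) *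
          (‖f k‖ₑ * (‖c (k - n)‖ₑ * ‖symb L n * f n‖ₑ)) := by ring
      _ ≤ _ := by gcongr <;> exact hWB _
  have hR : Summable R := (hF.sub hG).congr fun q => by rw [hFGR]; ring
  have hsum : ∑' k, (W k : ℂ) ^ 2 * (conj (f k) * ∑' n, c (k - n) * (symb L n * f n)) =
      ∑' q, G q + ∑' q, R q := by
    rw [← hG.tsum_add hR, ← tsum_congr hFGR, hF.tsum_prod]
    congr 1
    ext k
    simp only [F, tsum_mul_left]
  -- antisymmetry of `v ∂_z` modulo `v_z`
  have hGre : ‖(∑' q, G q).re‖ₑ ≤ l1 (fun n => symb L n * c n) * l2 g ^ 2 := by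
    have hswap : ∑' q, conj (G q) = ∑' q : ℤ × ℤ, conj (G q.swap) :=
      ((Equiv.prodComm ℤ ℤ).tsum_eq fun q => conj (G q)).symm
    have hGs : Summable fun q : ℤ × ℤ => conj (G q.swap) := by
      have h1 : Summable fun q => conj (G q) := (Complex.conjCLE.summable (f := G)).2 hG
      exact (Equiv.prodComm ℤ ℤ).summable_iff.2 h1
    have h2 : (((2 * (∑' q, G q).re : ℝ)) : ℂ) = ∑' q : ℤ × ℤ,
        -(conj (g q.1) * ((symb L (q.1 - q.2) * c (q.1 - q.2)) * g q.2)) := by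
      rw [← Complex.add_conj, Complex.conj_tsum, hswap, ← hG.tsum_add hGs]
      congr 1
      ext q
      simp only [G, Prod.fst_swap, Prod.snd_swap, map_mul, Complex.conj_conj, conj_symb, symb_sub]
      rw [← neg_sub q.1 q.2, hc, Complex.conj_conj]
      ring
    have h3 : ‖(2 * (∑' q, G q).re : ℝ)‖ₑ ≤ l1 (fun n => symb L n * c n) * l2 g ^ 2 := by
      have h4 : ‖(((2 * (∑' q, G q).re : ℝ)) : ℂ)‖ₑ ≤ l1 (fun n => symb L n * c n) * l2 g ^ 2 := by
        rw [h2]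
        refine enorm_tsum_le_tsum_enorm.trans ?_
        simp only [enorm_neg, enorm_mul (conj _), RCLike.enorm_conj]
        rw [ENNReal.tsum_prod', pow_two]
        simpa only [enorm_mul] using tsum_tsum_le_l1_left (fun n => symb L n * c n) g g
      rwa [← ofReal_norm, Complex.norm_real, ofReal_norm] at h4
    refine le_trans ?_ h3
    rw [enorm_mul]
    refine le_mul_of_one_le_left zero_le ?_
    rw [Real.enorm_eq_ofReal (by norm_num)]
    norm_num
  have hRn : ‖∑' q, R q‖ₑ ≤ ENNReal.ofReal A * (l1 (fun n => symb L n * c n) * l2 g ^ 2 +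
      l1 (fun n => W n * c n) * (l2 g * l2 (fun n => symb L n * f n))) := by
    refine enorm_tsum_le_tsum_enorm.trans ?_
    rw [ENNReal.tsum_prod']
    have hpt : ∀ k n, ‖R (k, n)‖ₑ ≤
        ENNReal.ofReal A * (‖g k‖ₑ * (‖symb L (k - n) * c (k - n)‖ₑ * ‖g n‖ₑ)) +
        ENNReal.ofReal A * (‖g k‖ₑ * (‖W (k - n) * c (k - n)‖ₑ * ‖symb L n * f n‖ₑ)) := by
      intro k n
      have h1 := ENNReal.ofReal_le_ofReal (hcomm k n)
      rw [ENNReal.ofReal_mul (abs_nonneg _), ENNReal.ofReal_mul hA, ENNReal.ofReal_add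
        (mul_nonneg (norm_nonneg _) (hW0 _)) (mul_nonneg (hW0 _) (norm_nonneg _)),
        ENNReal.ofReal_mul (norm_nonneg _), ENNReal.ofReal_mul (hW0 _), ofReal_norm,
        ofReal_norm] at h1
      simp only [R]
      have e1 : ‖((W k - W n : ℝ) : ℂ)‖ₑ = ENNReal.ofReal |W k - W n| := by
        rw [← ofReal_norm, Complex.norm_real, Real.norm_eq_abs]
      have e2 : ‖g n‖ₑ = ENNReal.ofReal (W n) * ‖f n‖ₑ := enorm_weight_mul _ _ (hW0 n)
      rw [enorm_weight_mul _ _ (hW0 (k - n))]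
      simp only [enorm_mul, RCLike.enorm_conj, e1, e2]
      calc _ ≤ ‖g k‖ₑ * (‖c (k - n)‖ₑ * (ENNReal.ofReal A *
            (‖symb L (k - n)‖ₑ * ENNReal.ofReal (W n) + ENNReal.ofReal (W (k - n)) * ‖symb L n‖ₑ) *
              ‖f n‖ₑ)) := by gcongr
        _ = _ := by ring
    refine (ENNReal.tsum_le_tsum fun k => ENNReal.tsum_le_tsum fun n => hpt k n).trans ?_
    simp only [ENNReal.tsum_add, ENNReal.tsum_mul_left]
    rw [mul_add]
    have y1 := tsum_tsum_le_l1_left (fun n => symb L n * c n) g g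
    have y2 := tsum_tsum_le_l1_left (fun n => W n * c n) g (fun n => symb L n * f n)
    simp only [ENNReal.tsum_mul_left] at y1 y2
    rw [pow_two]
    gcongr
  rw [hsum, Complex.add_re]
  refine (enorm_add_le _ _).trans ?_
  rw [add_mul, one_mul]
  gcongr
  · exact hGre.trans le_self_add
  · refine le_trans ?_ hRn
    rw [← ofReal_norm, ← ofReal_norm]
    exact ENNReal.ofReal_le_ofReal (Complex.abs_re_le_norm _)

/-- The product `h f`, paired with `f` in a weighted `ℓ²` space. -/
theorem tsum_enorm_weight_conv_le {W : ℤ → ℝ} {A : ℝ} (hA : 0 ≤ A) (hW0 : ∀ n, 0 ≤ W n)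
    (hadd : ∀ k n, W k ≤ A * (W (k - n) + W n)) (h f : ℤ → ℂ) :
    ∑' k, ‖(W k : ℂ) ^ 2 * (conj (f k) * ∑' n, h (k - n) * f n)‖ₑ ≤
      ENNReal.ofReal A * (l1 f * (l2 (fun n => W n * f n) * l2 (fun n => W n * h n)) +
        l1 h * l2 (fun n => W n * f n) ^ 2) := by
  set g : ℤ → ℂ := fun n => W n * f n with hg
  have hpt : ∀ k, ‖(W k : ℂ) ^ 2 * (conj (f k) * ∑' n, h (k - n) * f n)‖ₑ ≤
      ∑' n, (ENNReal.ofReal A * (‖g k‖ₑ * (‖W (k - n) * h (k - n)‖ₑ * ‖f n‖ₑ)) +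
        ENNReal.ofReal A * (‖g k‖ₑ * (‖h (k - n)‖ₑ * ‖g n‖ₑ))) := by
    intro k
    rw [pow_two, mul_assoc, enorm_weight_mul _ _ (hW0 k), enorm_weight_mul _ _ (hW0 k), enorm_mul,
      RCLike.enorm_conj]
    calc _ ≤ ENNReal.ofReal (W k) * (ENNReal.ofReal (W k) * (‖f k‖ₑ * ∑' n, ‖h (k - n) * f n‖ₑ)) := by
          gcongr
          exact enorm_tsum_le_tsum_enorm
      _ = ∑' n, ‖g k‖ₑ * (ENNReal.ofReal (W k) * (‖h (k - n)‖ₑ * ‖f n‖ₑ)) := by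
          simp only [hg, enorm_weight_mul _ _ (hW0 k), ENNReal.tsum_mul_left, enorm_mul]
          ring
      _ ≤ _ := by
          gcongr with n
          have h1 := ENNReal.ofReal_le_ofReal (hadd k n)
          rw [ENNReal.ofReal_mul hA, ENNReal.ofReal_add (hW0 _) (hW0 _)] at h1
          have e2 : ‖g n‖ₑ = ENNReal.ofReal (W n) * ‖f n‖ₑ := enorm_weight_mul _ _ (hW0 n)
          rw [enorm_weight_mul _ _ (hW0 (k - n)), e2]
          calc _ ≤ ‖g k‖ₑ * (ENNReal.ofReal A *
                (ENNReal.ofReal (W (k - n)) + ENNReal.ofReal (W n)) * (‖h (k - n)‖ₑ * ‖f n‖ₑ)) := by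
                gcongr
            _ = _ := by ring
  refine (ENNReal.tsum_le_tsum hpt).trans ?_
  simp only [ENNReal.tsum_add, ENNReal.tsum_mul_left]
  rw [mul_add]
  have y1 := tsum_tsum_le_l1_right f g (fun n => W n * h n)
  have y2 := tsum_tsum_le_l1_left h g g
  simp only [ENNReal.tsum_mul_left] at y1 y2
  rw [pow_two]
  gcongr

end

section

variable {L : ℝ} [hL : Fact (0 < L)]

/-! ### The energy inequality for Fourier coefficients -/

theorem abs_weight_sub_mul_norm_symb_le (m N : ℕ) (k n : ℤ) :
    |weight (m + 1) N k - weight (m + 1) N n| * ‖symb L n‖ ≤ ((m + 1) * 2 ^ (m + 1)) *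
      (‖symb L (k - n)‖ * weight (m + 1) N n + weight (m + 1) N (k - n) * ‖symb L n‖) := by
  have hL' := hL.out
  have hpi := Real.pi_pos
  have h := mul_le_mul_of_nonneg_left (abs_weight_sub_mul_le m N k n)
    (show 0 ≤ 2 * Real.pi / L by positivity)
  rw [norm_symb, norm_symb]
  linarith

/-- The constant `‖(2πin/L)⁻¹‖_{ℓ²}` in the embedding `‖f‖_{ℓ¹} ≤ C ‖2πin/L f‖_{ℓ²}`; the term
`n = 0` vanishes. -/
def embConst (L : ℝ) : ℝ≥0∞ := l2 fun n => (symb L n)⁻¹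

theorem embConst_ne_top : embConst L ≠ ⊤ := by
  have h1 : Summable fun n : ℤ => ‖(symb L n)⁻¹‖ ^ 2 := by
    have := (Real.summable_one_div_int_pow.2 (show 1 < 2 by norm_num)).mul_left
      ((2 * Real.pi / L)⁻¹ ^ 2)
    refine this.congr fun n => ?_
    rw [norm_inv, norm_symb, mul_inv, mul_pow, inv_pow |(n : ℝ)|, sq_abs, one_div]
  have h2 := h1.tsum_ofReal_ne_top
  unfold embConst l2
  apply ENNReal.rpow_ne_top_of_nonneg (by norm_num)
  simpa only [ENNReal.ofReal_pow (norm_nonneg _), ofReal_norm] using h2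

theorem l1_le {f : ℤ → ℂ} (hf : f 0 = 0) : l1 f ≤ embConst L * l2 (fun n => symb L n * f n) := by
  refine le_trans (le_of_eq ?_) (tsum_mul_le_l2_mul_l2 _ _)
  unfold l1
  congr 1
  ext n
  rcases eq_or_ne n 0 with rfl | hn
  · simp [hf]
  · rw [← enorm_mul, inv_mul_cancel_left₀ (symb_ne_zero hn)]

theorem mul_le_sq_add_sq (x y : ℝ≥0∞) : x * y ≤ x ^ 2 + y ^ 2 := by
  rw [pow_two, pow_two]
  rcases le_total x y with h | h
  · exact (mul_le_mul_left h y).trans le_add_self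
  · exact (mul_le_mul_right h x).trans le_self_add

theorem l2_weight_ne_top (m N : ℕ) {f : ℤ → ℂ} (hf : l2 f ≠ ⊤) :
    l2 (fun n => weight m N n * f n) ≠ ⊤ := by
  have h : l2 (fun n => weight m N n * f n) ^ 2 ≤ (ENNReal.ofReal (N ^ m) * l2 f) ^ 2 := by
    rw [mul_pow, l2_sq, l2_sq, ← ENNReal.tsum_mul_left]
    gcongr with n
    rw [enorm_weight_mul _ _ (weight_nonneg m N n), mul_pow]
    gcongr
    exact weight_le m N n
  exact ne_top_of_le_ne_top (ENNReal.mul_ne_top ENNReal.ofReal_ne_top hf)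
    ((ENNReal.pow_le_pow_left_iff two_ne_zero).1 h)

/-- The growth rate in the energy inequality; it does not depend on the cutoff of the weight. -/
def rate (L : ℝ) (m : ℕ) (K : ℝ≥0∞) : ℝ≥0∞ :=
  (4 * (1 + ENNReal.ofReal ((m + 1) * 2 ^ (m + 1))) + 2 * ENNReal.ofReal (2 ^ (m + 1))) *
    (embConst L * K) + 1

theorem rate_ne_top (m : ℕ) {K : ℝ≥0∞} (hK : K ≠ ⊤) : rate L m K ≠ ⊤ := by
  have := embConst_ne_top (L := L)
  unfold rate
  finiteness

/-- The energy estimate in terms of the Fourier coefficients `p`, `b`, `c` of `u_z`, `ω`, `v`: the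
weighted `ℓ²` energy of `(p, b)` grows at most at a rate that is independent of the cutoff `N`. -/
theorem enorm_energy_rate_le (m N : ℕ) {p b c : ℤ → ℂ} {K : ℝ≥0∞} (hK : K ≠ ⊤)
    (hp0 : p 0 = 0) (hc0 : c 0 = 0) (hc : ∀ n, c (-n) = conj (c n))
    (hcb : ∀ n, ‖symb L n * c n‖ₑ ≤ ‖b n‖ₑ) (hp2 : l2 p ≠ ⊤) (hb2 : l2 b ≠ ⊤)
    (hpK : l2 (fun n => symb L n * p n) ≤ K) (hbK : l2 (fun n => symb L n * b n) ≤ K) :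
    ‖(∑' k, (weight (m + 1) N k : ℂ) ^ 2 *
        (conj (p k) * (symb L k * -∑' n, c (k - n) * p n))).re +
      (∑' k, (weight (m + 1) N k : ℂ) ^ 2 *
        (conj (b k) * (-(∑' n, c (k - n) * (symb L n * b n)) + p k))).re‖ₑ ≤
      rate L m K * (l2 (fun n => weight (m + 1) N n * p n) ^ 2 +
        l2 (fun n => weight (m + 1) N n * b n) ^ 2) := by
  set W := weight (m + 1) N with hW
  have hW0 : ∀ n, 0 ≤ W n := weight_nonneg (m + 1) N
  set A : ℝ := (m + 1) * 2 ^ (m + 1) with hA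
  have hA0 : 0 ≤ A := by positivity
  set x := l2 (fun n => W n * p n)
  set y := l2 (fun n => W n * b n)
  set Z := embConst L
  have hx : x ≠ ⊤ := l2_weight_ne_top _ _ hp2
  have hy : y ≠ ⊤ := l2_weight_ne_top _ _ hb2
  have hZ : Z ≠ ⊤ := embConst_ne_top
  set h : ℤ → ℂ := fun n => symb L n * c n with hh
  have hp1 : l1 p ≤ Z * K := (l1_le hp0).trans (by gcongr)
  have hh1 : l1 h ≤ Z * K := by
    refine (l1_le (L := L) (by simp [hh, hc0])).trans (mul_le_mul_right ?_ Z)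
    refine (l2_mono fun n => ?_).trans hbK
    rw [enorm_mul _ (h n), enorm_mul _ (b n)]
    exact mul_le_mul_right (hcb n) _
  have hc1 : l1 c ≠ ⊤ :=
    ne_top_of_le_ne_top (ENNReal.mul_ne_top hZ hb2) ((l1_le hc0).trans (by gcongr; exact l2_mono hcb))
  have hWh : l2 (fun n => W n * h n) ≤ y := l2_mono fun n => by
    rw [enorm_mul _ (h n), enorm_mul _ (b n)]
    exact mul_le_mul_right (hcb n) _
  have hWc : l1 (fun n => W n * c n) ≤ Z * y := by
    refine (l1_le (L := L) (by simp [hc0])).trans (mul_le_mul_right ?_ Z)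
    refine le_trans (le_of_eq ?_) hWh
    congr 1
    ext n
    simp only [hh]
    ring
  have hpK' : l2 (fun n => symb L n * p n) ≠ ⊤ := ne_top_of_le_ne_top hK hpK
  have hbK' : l2 (fun n => symb L n * b n) ≠ ⊤ := ne_top_of_le_ne_top hK hbK
  have hcomm : ∀ k n, |W k - W n| * ‖symb L n‖ ≤
      A * (‖symb L (k - n)‖ * W n + W (k - n) * ‖symb L n‖) :=
    abs_weight_sub_mul_norm_symb_le m N
  have hWB : ∀ n, W n ≤ (N : ℝ) ^ (m + 1) := weight_le (m + 1) N
  have Tp := enorm_re_transport_le hA0 hW0 hWB hcomm hc hc1 hp2 hpK'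
  have Tb := enorm_re_transport_le hA0 hW0 hWB hcomm hc hc1 hb2 hbK'
  have Cp := tsum_enorm_weight_conv_le (A := 2 ^ (m + 1)) (by positivity) hW0
    (weight_le_add (m + 1) N) h p
  have Bp : ∑' k, ‖(W k : ℂ) ^ 2 * (conj (b k) * p k)‖ₑ ≤ y * x := by
    refine le_trans (le_of_eq ?_) (tsum_mul_le_l2_mul_l2 (fun n => W n * b n) (fun n => W n * p n))
    congr 1
    ext k
    simp only [enorm_mul, RCLike.enorm_conj, pow_two]
    ring
  -- summability of the series that are to be separated
  have hST : ∀ f : ℤ → ℂ, l2 f ≠ ⊤ → l2 (fun n => symb L n * f n) ≠ ⊤ → Summable fun k =>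
      (W k : ℂ) ^ 2 * (conj (f k) * ∑' n, c (k - n) * (symb L n * f n)) := by
    intro f hf hf'
    apply summable_of_tsum_enorm_ne_top
    refine ne_top_of_le_ne_top (b := ENNReal.ofReal (N ^ (m + 1)) * ENNReal.ofReal (N ^ (m + 1)) *
      (l1 c * (l2 f * l2 (fun n => symb L n * f n))))
      (by finiteness) ?_
    refine le_trans ?_ (mul_le_mul_right (tsum_tsum_le_l1_left c f (fun n => symb L n * f n)) _)
    rw [← ENNReal.tsum_mul_left]
    gcongr with k
    rw [pow_two, mul_assoc, enorm_weight_mul _ _ (hW0 k), enorm_weight_mul _ _ (hW0 k), enorm_mul,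
      RCLike.enorm_conj, ENNReal.tsum_mul_left, ← mul_assoc]
    gcongr
    · exact hWB k
    · exact hWB k
    · refine enorm_tsum_le_tsum_enorm.trans (le_of_eq ?_)
      simp only [enorm_mul]
  have hSTp := hST p hp2 hpK'
  have hSTb := hST b hb2 hbK'
  have hSC : Summable fun k => (W k : ℂ) ^ 2 * (conj (p k) * ∑' n, h (k - n) * p n) := by
    apply summable_of_tsum_enorm_ne_top
    refine ne_top_of_le_ne_top ?_ Cp
    have h1 : l1 p ≠ ⊤ := ne_top_of_le_ne_top (ENNReal.mul_ne_top hZ hK) hp1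
    have h2 : l1 h ≠ ⊤ := ne_top_of_le_ne_top (ENNReal.mul_ne_top hZ hK) hh1
    have h3 : l2 (fun n => W n * h n) ≠ ⊤ := ne_top_of_le_ne_top hy hWh
    finiteness
  have hSB : Summable fun k => (W k : ℂ) ^ 2 * (conj (b k) * p k) :=
    summable_of_tsum_enorm_ne_top (ne_top_of_le_ne_top (by finiteness) Bp)
  have e1 : ∑' k, (W k : ℂ) ^ 2 * (conj (p k) * (symb L k * -∑' n, c (k - n) * p n)) =
      -∑' k, (W k : ℂ) ^ 2 * (conj (p k) * ∑' n, c (k - n) * (symb L n * p n)) -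
      ∑' k, (W k : ℂ) ^ 2 * (conj (p k) * ∑' n, h (k - n) * p n) := by
    rw [← tsum_neg, ← hSTp.neg.tsum_sub hSC]
    congr 1
    ext k
    have hs1 : Summable fun n => c (k - n) * (symb L n * p n) := summable_conv hc1 hpK' k
    have hs2 : Summable fun n => h (k - n) * p n :=
      summable_conv (ne_top_of_le_ne_top (ENNReal.mul_ne_top hZ hK) hh1) hp2 k
    have h3 : symb L k * ∑' n, c (k - n) * p n =
        ∑' n, c (k - n) * (symb L n * p n) + ∑' n, h (k - n) * p n := by
      rw [← tsum_mul_left, ← hs1.tsum_add hs2]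
      congr 1
      ext n
      simp only [hh, symb_sub]
      ring
    rw [mul_neg, h3]
    ring
  have e2 : ∑' k, (W k : ℂ) ^ 2 * (conj (b k) * (-(∑' n, c (k - n) * (symb L n * b n)) + p k)) =
      -∑' k, (W k : ℂ) ^ 2 * (conj (b k) * ∑' n, c (k - n) * (symb L n * b n)) +
      ∑' k, (W k : ℂ) ^ 2 * (conj (b k) * p k) := by
    rw [← tsum_neg, ← hSTb.neg.tsum_add hSB]
    congr 1
    ext k
    ring
  have hre : ∀ z : ℂ, ‖z.re‖ₑ ≤ ‖z‖ₑ := fun z => by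
    rw [← ofReal_norm, ← ofReal_norm]
    exact ENNReal.ofReal_le_ofReal (Complex.abs_re_le_norm z)
  have hxy : x * y ≤ x ^ 2 + y ^ 2 := mul_le_sq_add_sq x y
  have b1 : ‖(∑' k, (W k : ℂ) ^ 2 * (conj (p k) * ∑' n, c (k - n) * (symb L n * p n))).re‖ₑ ≤
      2 * (1 + ENNReal.ofReal A) * (Z * K) * (x ^ 2 + y ^ 2) := by
    refine Tp.trans ?_
    calc _ ≤ (1 + ENNReal.ofReal A) * (Z * K * x ^ 2 + Z * y * (x * K)) := by gcongr
      _ = (1 + ENNReal.ofReal A) * (Z * K) * (x ^ 2 + x * y) := by ring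
      _ ≤ (1 + ENNReal.ofReal A) * (Z * K) * ((x ^ 2 + y ^ 2) + (x ^ 2 + y ^ 2)) := by
        gcongr
        exact le_self_add
      _ = _ := by ring
  have b2 : ‖(∑' k, (W k : ℂ) ^ 2 * (conj (b k) * ∑' n, c (k - n) * (symb L n * b n))).re‖ₑ ≤
      2 * (1 + ENNReal.ofReal A) * (Z * K) * (x ^ 2 + y ^ 2) := by
    refine Tb.trans ?_
    calc _ ≤ (1 + ENNReal.ofReal A) * (Z * K * y ^ 2 + Z * y * (y * K)) := by gcongr
      _ = 2 * (1 + ENNReal.ofReal A) * (Z * K) * y ^ 2 := by ring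
      _ ≤ _ := by
        gcongr
        exact le_add_self
  have b3 : ‖∑' k, (W k : ℂ) ^ 2 * (conj (p k) * ∑' n, h (k - n) * p n)‖ₑ ≤
      2 * ENNReal.ofReal (2 ^ (m + 1)) * (Z * K) * (x ^ 2 + y ^ 2) := by
    refine (enorm_tsum_le_tsum_enorm.trans Cp).trans ?_
    calc _ ≤ ENNReal.ofReal (2 ^ (m + 1)) * (Z * K * (x * y) + Z * K * x ^ 2) := by gcongr
      _ = ENNReal.ofReal (2 ^ (m + 1)) * (Z * K) * (x * y + x ^ 2) := by ring
      _ ≤ ENNReal.ofReal (2 ^ (m + 1)) * (Z * K) * ((x ^ 2 + y ^ 2) + (x ^ 2 + y ^ 2)) := by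
        gcongr
        exact le_self_add
      _ = _ := by ring
  have b4 : ‖∑' k, (W k : ℂ) ^ 2 * (conj (b k) * p k)‖ₑ ≤ x ^ 2 + y ^ 2 :=
    (enorm_tsum_le_tsum_enorm.trans Bp).trans (by rwa [mul_comm])
  rw [e1, e2, Complex.sub_re, Complex.add_re, Complex.neg_re, Complex.neg_re]
  refine (enorm_add_le _ _).trans ?_
  refine (add_le_add (enorm_sub_le.trans (add_le_add (enorm_neg _).le le_rfl))
    ((enorm_add_le _ _).trans (add_le_add (enorm_neg _).le le_rfl))).trans ?_
  refine (add_le_add (add_le_add b1 ((hre _).trans b3))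
    (add_le_add b2 ((hre _).trans b4))).trans (le_of_eq ?_)
  rw [rate]
  ring

end

section

variable {L : ℝ}

/-! ### Differentiability of weighted energies in time -/

theorem symb_sq (n : ℤ) : symb L n ^ 2 = -((‖symb L n‖ ^ 2 : ℝ) : ℂ) := by
  rw [Complex.sq_norm, ← Complex.mul_conj, conj_symb]
  ring

variable [hL : Fact (0 < L)]

/-- A bounded even sequence acts on `L²(S)` as a Fourier multiplier. -/
theorem exists_multiplier {μ : ℤ → ℝ} {B : ℝ} (hB : ∀ n, |μ n| ≤ B) (heven : ∀ n, μ (-n) = μ n) :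
    ∃ M : L2S L →L[ℝ] L2S L, ∀ f n, coef (M f) n = μ n * coef f n := by
  have hL' := hL.out
  have hB0 : 0 ≤ B := (abs_nonneg _).trans (hB 0)
  have hle : ∀ (f : L2S L) n, ‖(μ n : ℂ) * coef f n‖ ^ 2 ≤ B ^ 2 * ‖coef f n‖ ^ 2 := fun f n => by
    rw [norm_mul, mul_pow, Complex.norm_real]
    gcongr
    exact hB n
  have hex : ∀ f : L2S L, ∃ g : L2S L, ∀ n, coef g n = μ n * coef f n := fun f =>
    exists_coef_eq (((hasSum_norm_coef_sq f).summable.mul_left (B ^ 2)).of_nonneg_of_le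
      (fun _ => by positivity) (hle f))
      (fun n => by rw [heven, coef_neg_index, map_mul, Complex.conj_ofReal])
  choose M hM using hex
  let M' : L2S L →ₗ[ℝ] L2S L :=
    { toFun := M
      map_add' := fun f g => coef_injective fun n => by
        rw [coef_add, hM, hM, hM, coef_add]; ring
      map_smul' := fun r f => coef_injective fun n => by
        rw [RingHom.id_apply, coef_smul, hM, hM, coef_smul]; ring }
  refine ⟨M'.mkContinuous B fun f => ?_, fun f n => hM f n⟩
  have h1 := hasSum_norm_coef_sq (M f)
  simp only [hM] at h1
  have h2 := hasSum_le (hle f) h1 ((hasSum_norm_coef_sq f).mul_left (B ^ 2))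
  rw [← mul_div_assoc, div_le_div_iff_of_pos_right hL', ← mul_pow] at h2
  exact (pow_le_pow_iff_left₀ (norm_nonneg _) (by positivity) two_ne_zero).1 h2

/-- The derivative of a symmetric quadratic form `⟪B U, U⟫`, where only continuity of `s ↦ B (U s)`
is known. -/
theorem hasDerivWithinAt_inner_of_symm {H : Type*} [NormedAddCommGroup H] [InnerProductSpace ℝ H]
    {U B : ℝ → H} {U' : H} {S : Set ℝ} {t : ℝ} (hU : HasDerivWithinAt U U' S t)
    (hB : ContinuousWithinAt B S t) (hsymm : ∀ s ∈ S, inner ℝ (B s) (U t) = inner ℝ (B t) (U s)) :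
    HasDerivWithinAt (fun s => inner ℝ (B s) (U s)) (2 * inner ℝ (B t) U') S t := by
  rw [hasDerivWithinAt_iff_tendsto_slope] at hU ⊢
  have hB' : Tendsto B (𝓝[S \ {t}] t) (𝓝 (B t)) := hB.mono_left (nhdsWithin_mono _ sdiff_subset)
  have h := (hB'.add (tendsto_const_nhds (x := B t))).inner (𝕜 := ℝ) hU
  rw [← two_smul ℝ (B t), real_inner_smul_left] at h
  refine h.congr' ?_
  filter_upwards [self_mem_nhdsWithin] with s hs
  rw [slope_def_module, slope_def_module, inner_smul_right, smul_eq_mul]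
  congr 1
  rw [inner_add_left, inner_sub_right, inner_sub_right, hsymm s hs.1]
  ring

/-- Differentiation of a weighted sum of squares of Fourier coefficients. -/
theorem hasDerivWithinAt_tsum_mul_norm_coef_sq {U B : ℝ → L2S L} {U' : L2S L} {S : Set ℝ} {t : ℝ}
    {μ : ℤ → ℝ} (ht : t ∈ S) (hU : HasDerivWithinAt U U' S t) (hB : ContinuousWithinAt B S t)
    (hBU : ∀ s ∈ S, ∀ n, coef (B s) n = μ n * coef (U s) n) :
    HasDerivWithinAt (fun s => ∑' n, μ n * ‖coef (U s) n‖ ^ 2)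
      (2 * (∑' n, (μ n : ℂ) * (conj (coef (U t) n) * coef U' n)).re) S t := by
  have hL' := hL.out
  have hP : ∀ s ∈ S, ∀ f : L2S L, HasSum (fun n => (μ n : ℂ) * (conj (coef (U s) n) * coef f n))
      ((inner ℝ (B s) f / L : ℝ) : ℂ) := by
    intro s hs f
    have h := hasSum_conj_coef_mul (B s) f
    simpa only [hBU s hs, map_mul, Complex.conj_ofReal, mul_assoc] using h
  have hsymm : ∀ s ∈ S, inner ℝ (B s) (U t) = inner ℝ (B t) (U s) := by
    intro s hs
    have h1 := Complex.hasSum_conj'.2 (hP s hs (U t))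
    rw [Complex.conj_ofReal] at h1
    have h2 := hP t ht (U s)
    have h3 : ∀ n, conj ((μ n : ℂ) * (conj (coef (U s) n) * coef (U t) n)) =
        (μ n : ℂ) * (conj (coef (U t) n) * coef (U s) n) := fun n => by
      rw [map_mul, map_mul, Complex.conj_conj, Complex.conj_ofReal]
      ring
    simp only [h3] at h1
    have h4 := Complex.ofReal_injective (h1.unique h2)
    exact (div_left_inj' hL'.ne').1 h4
  have hd := (hasDerivWithinAt_inner_of_symm hU hB hsymm).div_const L
  have hval : ∀ s ∈ S, ∑' n, μ n * ‖coef (U s) n‖ ^ 2 = inner ℝ (B s) (U s) / L := by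
    intro s hs
    have h := Complex.hasSum_re (hP s hs (U s))
    rw [Complex.ofReal_re] at h
    rw [← h.tsum_eq]
    congr 1
    ext n
    rw [mul_comm (conj _), Complex.mul_conj, ← Complex.sq_norm, ← Complex.ofReal_mul,
      Complex.ofReal_re]
  rw [(hP t ht U').tsum_eq, Complex.ofReal_re, ← mul_div_assoc]
  exact hd.congr hval (hval t ht)

theorem l2_coef_sq (f : L2S L) : l2 (coef f) ^ 2 = ENNReal.ofReal (‖f‖ ^ 2 / L) := by
  have h := hasSum_norm_coef_sq f
  rw [l2_sq, ← h.tsum_eq, ENNReal.ofReal_tsum_of_nonneg (fun _ => by positivity) h.summable]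
  simp only [ENNReal.ofReal_pow (norm_nonneg _), ofReal_norm]

theorem l2_coef_ne_top (f : L2S L) : l2 (coef f) ≠ ⊤ := by
  intro h
  have := l2_coef_sq f
  rw [h] at this
  simp at this

theorem summable_weight_sq_mul (m N : ℕ) (f : L2S L) :
    Summable fun k => weight m N k ^ 2 * ‖coef f k‖ ^ 2 :=
  ((hasSum_norm_coef_sq f).summable.mul_left (((N : ℝ) ^ m) ^ 2)).of_nonneg_of_le
    (fun _ => by positivity) fun k => by
      gcongr
      · exact weight_nonneg m N k
      · exact weight_le m N k

/-- The energy `∑ min (|k|, N) ^ (2m) (|f̂(k)|² + |ĝ(k)|²)`. -/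
def energy (m N : ℕ) (f g : L2S L) : ℝ :=
  ∑' k, weight m N k ^ 2 * ‖coef f k‖ ^ 2 + ∑' k, weight m N k ^ 2 * ‖coef g k‖ ^ 2

theorem energy_nonneg (m N : ℕ) (f g : L2S L) : 0 ≤ energy m N f g :=
  add_nonneg (tsum_nonneg fun _ => by positivity) (tsum_nonneg fun _ => by positivity)

theorem l2_weight_coef_sq (m N : ℕ) (f : L2S L) :
    l2 (fun n => weight m N n * coef f n) ^ 2 =
      ENNReal.ofReal (∑' k, weight m N k ^ 2 * ‖coef f k‖ ^ 2) := by
  rw [l2_sq, ENNReal.ofReal_tsum_of_nonneg (fun _ => by positivity) (summable_weight_sq_mul m N f)]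
  congr 1
  ext k
  rw [enorm_weight_mul _ _ (weight_nonneg m N k), ENNReal.ofReal_mul (by positivity),
    ENNReal.ofReal_pow (norm_nonneg _), ENNReal.ofReal_pow (weight_nonneg m N k), ofReal_norm,
    mul_pow]

theorem ofReal_energy (m N : ℕ) (f g : L2S L) : ENNReal.ofReal (energy m N f g) =
    l2 (fun n => weight m N n * coef f n) ^ 2 + l2 (fun n => weight m N n * coef g n) ^ 2 := by
  rw [l2_weight_coef_sq, l2_weight_coef_sq, ← ENNReal.ofReal_add
    (tsum_nonneg fun _ => by positivity) (tsum_nonneg fun _ => by positivity), energy]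

theorem coef_of_ae_eq_neg_mul {f g h : L2S L} (hae : ∀ᵐ z : AddCircle L, f z = -(g z * h z))
    (k : ℤ) : coef f k = -∑' n, coef g (k - n) * coef h n := by
  rw [(hasSum_coef_mul g h k).tsum_eq, ← neg_one_mul, ← fourierCoeff.const_mul]
  apply coef_congr
  filter_upwards [hae] with z hz
  rw [hz]
  push_cast
  ring

/-- Time derivatives of the energies of a solution, and their growth rate. -/
theorem exists_hasDerivWithinAt_energy {T : ℝ} {u w v ut wt : ℝ → L2S L} {t R : ℝ}
    (ht : t ∈ Icc 0 T) (hu : ∀ s ∈ Icc 0 T, u s ∈ sobolevH L 2)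
    (huc : ContinuousOn (fun s => weakDeriv 2 (u s)) (Icc 0 T))
    (hw : ∀ s ∈ Icc 0 T, w s ∈ sobolevV L 1)
    (huR : ‖weakDeriv 2 (u t)‖ ≤ R) (hwR : ‖weakDeriv 1 (w t)‖ ≤ R)
    (hv : IsVelocity (w t) (v t)) (hut : HasDerivWithinAt u (ut t) (Icc 0 T) t)
    (hwt : HasDerivWithinAt w (wt t) (Icc 0 T) t)
    (hequ : ∀ᵐ z : AddCircle L, ut t z + v t z * weakDeriv 1 (u t) z = 0)
    (heqw : ∀ᵐ z : AddCircle L, wt t z + v t z * weakDeriv 1 (w t) z = weakDeriv 1 (u t) z)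
    (m N : ℕ) :
    ∃ e : ℝ, HasDerivWithinAt (fun s => energy (m + 1) N (weakDeriv 1 (u s)) (w s)) e (Icc 0 T) t ∧
      |e| ≤ 2 * (rate L m (ENNReal.ofReal (R / √L))).toReal *
        energy (m + 1) N (weakDeriv 1 (u t)) (w t) := by
  have hL' := hL.out
  have hu1 : ∀ s ∈ Icc 0 T, u s ∈ sobolevH L 1 := fun s hs => sobolevH_mono one_le_two (hu s hs)
  have hp : ∀ s ∈ Icc 0 T, ∀ k, coef (weakDeriv 1 (u s)) k = symb L k * coef (u s) k :=
    fun s hs k => by rw [coef_weakDeriv (hu1 s hs), pow_one]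
  have hWB : ∀ k, |weight (m + 1) N k ^ 2| ≤ ((N : ℝ) ^ (m + 1)) ^ 2 := fun k => by
    rw [abs_of_nonneg (by positivity)]
    gcongr
    · exact weight_nonneg _ _ _
    · exact weight_le _ _ _
  obtain ⟨M, hM⟩ := exists_multiplier (L := L) hWB (fun n => by rw [weight_neg])
  -- `-W(D)² ∂_z²` is the symmetric operator defining the energy of `u_z` as a form in `u`
  have d1 := hasDerivWithinAt_tsum_mul_norm_coef_sq (B := fun s => -M (weakDeriv 2 (u s)))
    (μ := fun k => weight (m + 1) N k ^ 2 * ‖symb L k‖ ^ 2) ht hut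
    (M.continuous.comp_continuousOn huc t ht).neg (fun s hs k => by
      rw [coef_neg, hM, coef_weakDeriv (hu s hs), symb_sq]
      push_cast
      ring)
  have d2 := hasDerivWithinAt_tsum_mul_norm_coef_sq (B := fun s => M (w s))
    (μ := fun k => weight (m + 1) N k ^ 2) ht hwt
    (M.continuous.continuousAt.comp_continuousWithinAt hwt.continuousWithinAt)
    (fun s hs k => hM _ _)
  have hen : ∀ s ∈ Icc 0 T, energy (m + 1) N (weakDeriv 1 (u s)) (w s) =
      ∑' k, weight (m + 1) N k ^ 2 * ‖symb L k‖ ^ 2 * ‖coef (u s) k‖ ^ 2 +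
        ∑' k, weight (m + 1) N k ^ 2 * ‖coef (w s) k‖ ^ 2 := by
    intro s hs
    rw [energy]
    congr 2
    ext k
    rw [hp s hs, norm_mul]
    ring
  refine ⟨_, (d1.add d2).congr hen (hen t ht), ?_⟩
  have cu : ∀ k, coef (ut t) k = -∑' n, coef (v t) (k - n) * coef (weakDeriv 1 (u t)) n :=
    coef_of_ae_eq_neg_mul (by filter_upwards [hequ] with z hz; linarith)
  have cw : ∀ k, coef (wt t) k =
      -(∑' n, coef (v t) (k - n) * (symb L n * coef (w t) n)) + coef (weakDeriv 1 (u t)) k := by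
    intro k
    have h := coef_of_ae_eq_neg_mul (f := wt t - weakDeriv 1 (u t)) (g := v t)
      (h := weakDeriv 1 (w t)) (by
        filter_upwards [heqw, Lp.coeFn_sub (wt t) (weakDeriv 1 (u t))] with z hz hz'
        rw [hz', Pi.sub_apply, ← hz]
        ring) k
    rw [coef_sub, sub_eq_iff_eq_add] at h
    simpa only [coef_weakDeriv (hw t ht).1, pow_one] using h
  have s1 : ∀ k, ((weight (m + 1) N k ^ 2 * ‖symb L k‖ ^ 2 : ℝ) : ℂ) *
      (conj (coef (u t) k) * coef (ut t) k) = (weight (m + 1) N k : ℂ) ^ 2 *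
        (conj (coef (weakDeriv 1 (u t)) k) *
          (symb L k * -∑' n, coef (v t) (k - n) * coef (weakDeriv 1 (u t)) n)) := by
    intro k
    rw [← cu k, hp t ht, map_mul, conj_symb]
    have := symb_sq (L := L) k
    push_cast at this ⊢
    linear_combination ((weight (m + 1) N k : ℂ) ^ 2 * conj (coef (u t) k) * coef (ut t) k) * this
  simp only [s1, cw]
  have hl2 : ∀ f : L2S L, ‖f‖ ≤ R → l2 (coef f) ≤ ENNReal.ofReal (R / √L) := by
    intro f hf
    have hR : 0 ≤ R := (norm_nonneg _).trans hf
    rw [← ENNReal.pow_le_pow_left_iff two_ne_zero, l2_coef_sq, ← ENNReal.ofReal_pow (by positivity),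
      div_pow, Real.sq_sqrt hL'.le]
    gcongr
  have hHv : ∀ k, symb L k * coef (v t) k = hilbertSymb k * coef (w t) k := fun k => by
    rw [← coef_of_isHilbertTransform (hw t ht).1 hv.2, coef_weakDeriv hv.1.1, pow_one]
  have key := enorm_energy_rate_le (L := L) m N (p := coef (weakDeriv 1 (u t))) (b := coef (w t))
    (c := coef (v t)) (K := ENNReal.ofReal (R / √L)) ENNReal.ofReal_ne_top
    (by rw [hp t ht, symb_zero, zero_mul]) (mean_eq_zero_iff.1 hv.1.2) (coef_neg_index _)
    (fun n => by
      rw [hHv, enorm_mul]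
      refine mul_le_of_le_one_left zero_le ?_
      rw [← ofReal_norm]
      exact ENNReal.ofReal_le_one.2 (norm_hilbertSymb_le n))
    (l2_coef_ne_top _) (l2_coef_ne_top _)
    (by
      refine le_trans (le_of_eq ?_) (hl2 _ huR)
      congr 1
      ext n
      rw [coef_weakDeriv (hu t ht), hp t ht]
      ring)
    (by
      refine le_trans (le_of_eq ?_) (hl2 _ hwR)
      congr 1
      ext n
      rw [coef_weakDeriv (hw t ht).1, pow_one])
  rw [← ofReal_energy] at key
  have hK := rate_ne_top (L := L) m (K := ENNReal.ofReal (R / √L)) ENNReal.ofReal_ne_top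
  have key2 := ENNReal.toReal_mono (ENNReal.mul_ne_top hK ENNReal.ofReal_ne_top) key
  rw [ENNReal.toReal_mul, ENNReal.toReal_ofReal (energy_nonneg _ _ _ _), toReal_enorm,
    Real.norm_eq_abs] at key2
  rw [← mul_add, abs_mul, abs_two, mul_assoc]
  have e3 : ∀ k, ((weight (m + 1) N k ^ 2 : ℝ) : ℂ) = (weight (m + 1) N k : ℂ) ^ 2 := fun k => by
    push_cast; rfl
  simp only [e3]
  gcongr

end

section

/-! ### From uniform energy bounds to strong continuity -/

/-- Gronwall's inequality, with the Lipschitz bound that it entails. -/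
theorem le_exp_and_lipschitz_of_abs_deriv_le {E : ℝ → ℝ} {T C M : ℝ} (hE : ∀ t, 0 ≤ E t)
    (hC : 0 ≤ C) (h0 : E 0 ≤ M)
    (h : ∀ t ∈ Icc 0 T, ∃ e, HasDerivWithinAt E e (Icc 0 T) t ∧ |e| ≤ C * E t) :
    (∀ t ∈ Icc 0 T, E t ≤ M * Real.exp (C * T)) ∧
      ∀ s ∈ Icc 0 T, ∀ t ∈ Icc 0 T, |E s - E t| ≤ C * (M * Real.exp (C * T)) * |s - t| := by
  choose! E' hd hb using h
  have hM : 0 ≤ M := (hE 0).trans h0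
  have h1 : ∀ t ∈ Icc 0 T, E t ≤ M * Real.exp (C * T) := by
    intro t ht
    have hg := norm_le_gronwallBound_of_norm_deriv_right_le (f := E) (f' := E') (δ := M) (K := C)
      (ε := 0) (a := 0) (b := T) (fun t ht => (hd t ht).continuousWithinAt)
      (fun t ht => (hd t ⟨ht.1, ht.2.le⟩).mono_of_mem_nhdsWithin
        (mem_of_superset (Icc_mem_nhdsGE ht.2) (Icc_subset_Icc_left ht.1)))
      (by rwa [Real.norm_of_nonneg (hE 0)])
      (fun t ht => by
        rw [add_zero, Real.norm_of_nonneg (hE t)]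
        exact hb t ⟨ht.1, ht.2.le⟩) t ht
    rw [Real.norm_of_nonneg (hE t), gronwallBound_ε0, sub_zero] at hg
    refine hg.trans ?_
    gcongr
    exact ht.2
  refine ⟨h1, fun s hs t ht => ?_⟩
  exact (convex_Icc 0 T).norm_image_sub_le_of_norm_hasDerivWithin_le hd
    (fun x hx => (hb x hx).trans (by gcongr; exact h1 x hx)) ht hs

/-- Removal of the cutoff in the weight. -/
theorem tendsto_tsum_weight_sq_mul {m : ℕ} {x : ℤ → ℝ} {M : ℝ} (hx : ∀ k, 0 ≤ x k)
    (hs : ∀ N, Summable fun k => weight m N k ^ 2 * x k)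
    (hM : ∀ N, ∑' k, weight m N k ^ 2 * x k ≤ M) :
    (Summable fun k : ℤ => (|(k : ℝ)| ^ m) ^ 2 * x k) ∧
      Tendsto (fun N => ∑' k, weight m N k ^ 2 * x k) atTop
        (𝓝 (∑' k : ℤ, (|(k : ℝ)| ^ m) ^ 2 * x k)) := by
  have hsum : Summable fun k : ℤ => (|(k : ℝ)| ^ m) ^ 2 * x k := by
    refine summable_of_sum_le (fun k => mul_nonneg (by positivity) (hx k)) (c := M) fun F => ?_
    let N := F.sup Int.natAbs
    refine le_trans ?_ (((hs N).sum_le_tsum F fun k _ => mul_nonneg (by positivity) (hx k)).trans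
      (hM N))
    exact (Finset.sum_congr rfl fun k hk => by rw [weight_eq (Finset.le_sup (f := Int.natAbs) hk)]).le
  refine ⟨hsum, tendsto_tsum_of_dominated_convergence hsum (fun k => ?_) ?_⟩
  · refine tendsto_const_nhds.congr' ?_
    filter_upwards [eventually_ge_atTop k.natAbs] with N hN
    rw [weight_eq hN]
  · filter_upwards with N k
    rw [Real.norm_of_nonneg (mul_nonneg (by positivity) (hx k))]
    gcongr
    · exact hx k
    · exact weight_nonneg _ _ _
    · exact weight_le_abs _ _ _

/-- In `ℓ²`, coordinatewise convergence together with convergence of the norms implies strong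
convergence. -/
theorem tendsto_tsum_norm_sub_sq {V ι α : Type*} [SeminormedAddCommGroup V] {l : Filter α}
    {X : α → ι → V} {Y : ι → V} (hX : ∀ᶠ s in l, Summable fun i => ‖X s i‖ ^ 2)
    (hY : Summable fun i => ‖Y i‖ ^ 2)
    (hlim : Tendsto (fun s => ∑' i, ‖X s i‖ ^ 2) l (𝓝 (∑' i, ‖Y i‖ ^ 2)))
    (hc : ∀ i, Tendsto (fun s => X s i) l (𝓝 (Y i))) :
    (∀ᶠ s in l, Summable fun i => ‖X s i - Y i‖ ^ 2) ∧
      Tendsto (fun s => ∑' i, ‖X s i - Y i‖ ^ 2) l (𝓝 0) := by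
  have hpt : ∀ x y : V, ‖x - y‖ ^ 2 ≤ 2 * ‖x‖ ^ 2 + 2 * ‖y‖ ^ 2 := fun x y => by
    have h := norm_sub_le x y
    have h2 : ‖x - y‖ ^ 2 ≤ (‖x‖ + ‖y‖) ^ 2 := by gcongr
    nlinarith [sq_nonneg (‖x‖ - ‖y‖)]
  have hS : ∀ s, (Summable fun i => ‖X s i‖ ^ 2) → Summable fun i => ‖X s i - Y i‖ ^ 2 :=
    fun s hs => ((hs.mul_left 2).add (hY.mul_left 2)).of_nonneg_of_le (fun _ => by positivity)
      fun i => hpt _ _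
  refine ⟨hX.mono hS, ?_⟩
  rw [tendsto_order]
  refine ⟨fun a ha => Eventually.of_forall fun s => ha.trans_le (tsum_nonneg fun _ => by positivity),
    fun ε hε => ?_⟩
  -- outside a finite set both norms are small, inside it the convergence is coordinatewise
  obtain ⟨F, hF⟩ : ∃ F : Finset ι, ∑' i, ‖Y i‖ ^ 2 - ε / 8 < ∑ i ∈ F, ‖Y i‖ ^ 2 :=
    (hY.hasSum.eventually (lt_mem_nhds (by linarith))).exists
  have hle : ∀ s, (Summable fun i => ‖X s i‖ ^ 2) → ∑' i, ‖X s i - Y i‖ ^ 2 ≤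
      ∑ i ∈ F, ‖X s i - Y i‖ ^ 2 + (2 * (∑' i, ‖X s i‖ ^ 2 - ∑ i ∈ F, ‖X s i‖ ^ 2) +
        2 * (∑' i, ‖Y i‖ ^ 2 - ∑ i ∈ F, ‖Y i‖ ^ 2)) := by
    intro s hs
    rw [← (hS s hs).sum_add_tsum_compl (s := F), ← hs.sum_add_tsum_compl (s := F),
      ← hY.sum_add_tsum_compl (s := F), add_sub_cancel_left, add_sub_cancel_left,
      ← tsum_mul_left, ← tsum_mul_left]
    have sX : Summable fun i : ((F : Set ι)ᶜ : Set ι) => 2 * ‖X s i‖ ^ 2 :=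
      (hs.subtype _).mul_left 2
    have sY : Summable fun i : ((F : Set ι)ᶜ : Set ι) => 2 * ‖Y i‖ ^ 2 :=
      (hY.subtype _).mul_left 2
    rw [← sX.tsum_add sY]
    have sD : Summable fun i : ((F : Set ι)ᶜ : Set ι) => ‖X s i - Y i‖ ^ 2 := (hS s hs).subtype _
    refine add_le_add le_rfl ?_
    exact sD.tsum_le_tsum (fun i => hpt _ _) (sX.add sY)
  have hlim2 : Tendsto (fun s => ∑ i ∈ F, ‖X s i - Y i‖ ^ 2 +
      (2 * (∑' i, ‖X s i‖ ^ 2 - ∑ i ∈ F, ‖X s i‖ ^ 2) +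
        2 * (∑' i, ‖Y i‖ ^ 2 - ∑ i ∈ F, ‖Y i‖ ^ 2))) l
      (𝓝 (∑ i ∈ F, ‖Y i - Y i‖ ^ 2 + (2 * (∑' i, ‖Y i‖ ^ 2 - ∑ i ∈ F, ‖Y i‖ ^ 2) +
        2 * (∑' i, ‖Y i‖ ^ 2 - ∑ i ∈ F, ‖Y i‖ ^ 2)))) := by
    refine (tendsto_finsetSum _ fun i _ => (((hc i).sub_const _).norm.pow 2)).add
      (((hlim.sub (tendsto_finsetSum _ fun i _ => ((hc i).norm.pow 2))).const_mul 2).add_const _)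
  have hlt : ∑ i ∈ F, ‖Y i - Y i‖ ^ 2 + (2 * (∑' i, ‖Y i‖ ^ 2 - ∑ i ∈ F, ‖Y i‖ ^ 2) +
        2 * (∑' i, ‖Y i‖ ^ 2 - ∑ i ∈ F, ‖Y i‖ ^ 2)) < ε := by
    have : ∑ i ∈ F, ‖Y i - Y i‖ ^ 2 = 0 := Finset.sum_eq_zero fun i _ => by simp
    rw [this]
    linarith
  filter_upwards [hX, hlim2.eventually (gt_mem_nhds hlt)] with s hs h1
  exact (hle s hs).trans_lt h1

variable {L : ℝ} [hL : Fact (0 < L)]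

/-! ### Propagation of regularity -/

theorem continuous_coef (n : ℤ) : Continuous fun f : L2S L => coef f n := by
  have hL' := hL.out
  let φ : L2S L →+ ℂ := AddMonoidHom.mk' (fun f => coef f n) fun f g => coef_add f g n
  refine AddMonoidHomClass.continuous_of_bound φ (1 / √L) fun f => ?_
  have h := norm_coef_sq_le f n
  have h2 : ‖coef f n‖ ^ 2 ≤ (1 / √L * ‖f‖) ^ 2 := by
    rw [mul_pow, div_pow, Real.sq_sqrt hL'.le]
    calc _ ≤ _ := h
      _ = _ := by ring
  exact (pow_le_pow_iff_left₀ (norm_nonneg _) (by positivity) two_ne_zero).1 h2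

theorem hasSum_norm_weakDeriv_sq {j : ℕ} {f : L2S L} (hf : f ∈ sobolevH L j) :
    HasSum (fun k : ℤ => L * (2 * Real.pi / L) ^ (2 * j) * (|(k : ℝ)| ^ j * ‖coef f k‖) ^ 2)
      (‖weakDeriv j f‖ ^ 2) := by
  have hL' := hL.out
  have h := (hasSum_norm_coef_sq (weakDeriv j f)).mul_left L
  rw [mul_div_cancel₀ _ hL'.ne'] at h
  refine h.congr_fun fun k => ?_
  rw [coef_weakDeriv hf, norm_mul, norm_pow, norm_symb]
  ring

theorem energy_eq_tsum (m N : ℕ) (f g : L2S L) :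
    energy m N f g = ∑' k, weight m N k ^ 2 * (‖coef f k‖ ^ 2 + ‖coef g k‖ ^ 2) := by
  rw [energy, ← (summable_weight_sq_mul m N f).tsum_add (summable_weight_sq_mul m N g)]
  simp only [mul_add]

theorem continuousOn_weakDeriv {T : ℝ} {j : ℕ} {f : ℝ → L2S L}
    (hf : ∀ t ∈ Icc 0 T, f t ∈ sobolevH L j)
    (h : ∀ t ∈ Icc 0 T, Tendsto (fun s => ‖weakDeriv j (f s - f t)‖) (𝓝[Icc 0 T] t) (𝓝 0)) :
    ContinuousOn (fun t => weakDeriv j (f t)) (Icc 0 T) := by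
  intro t ht
  rw [ContinuousWithinAt, tendsto_iff_norm_sub_tendsto_zero]
  refine (h t ht).congr' ?_
  filter_upwards [self_mem_nhdsWithin] with s hs
  rw [weakDeriv_sub (hf s hs) (hf t ht)]

/-- Propagation of regularity, in the seminorms `‖∂_z^{m+2} u‖` and `‖∂_z^{m+1} ω‖`, which do not
see the mean of `u`. -/
theorem propagation {T : ℝ} (hT : 0 ≤ T) {u w : ℝ → L2S L} (hsol : IsSolution T u w)
    (hw : ContinuousInV 1 T w) (hu : ∀ t ∈ Icc 0 T, u t ∈ sobolevH L 2)
    (huc : ContinuousOn (fun t => weakDeriv 2 (u t)) (Icc 0 T)) (m : ℕ)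
    (hu0 : u 0 ∈ sobolevH L (m + 2)) (hw0 : w 0 ∈ sobolevH L (m + 1)) :
    ∀ t ∈ Icc 0 T, u t ∈ sobolevH L (m + 2) ∧ w t ∈ sobolevH L (m + 1) ∧
      Tendsto (fun s => ‖weakDeriv (m + 2) (u s - u t)‖) (𝓝[Icc 0 T] t) (𝓝 0) ∧
      Tendsto (fun s => ‖weakDeriv (m + 1) (w s - w t)‖) (𝓝[Icc 0 T] t) (𝓝 0) := by
  have hL' := hL.out
  have hpi := Real.pi_pos
  obtain ⟨v, ut, wt, hs⟩ := hsol
  have h0 : (0 : ℝ) ∈ Icc 0 T := ⟨le_rfl, hT⟩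
  have hwH : ∀ t ∈ Icc 0 T, w t ∈ sobolevH L 1 := fun t ht => (hw t ht).1.1
  have hwc := continuousOn_weakDeriv hwH fun t ht => (hw t ht).2
  obtain ⟨R₁, hR₁⟩ := isCompact_Icc.exists_bound_of_continuousOn huc
  obtain ⟨R₂, hR₂⟩ := isCompact_Icc.exists_bound_of_continuousOn hwc
  have hp : ∀ s ∈ Icc 0 T, ∀ k, coef (weakDeriv 1 (u s)) k = symb L k * coef (u s) k :=
    fun s hs k => by rw [coef_weakDeriv (sobolevH_mono one_le_two (hu s hs)), pow_one]
  let x : ℝ → ℤ → ℝ := fun t k => ‖coef (weakDeriv 1 (u t)) k‖ ^ 2 + ‖coef (w t) k‖ ^ 2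
  have hx : ∀ t k, 0 ≤ x t k := fun t k => by positivity
  have hxs : ∀ t N, Summable fun k => weight (m + 1) N k ^ 2 * x t k := fun t N => by
    simpa only [x, mul_add] using (summable_weight_sq_mul (m + 1) N (weakDeriv 1 (u t))).add
      (summable_weight_sq_mul (m + 1) N (w t))
  -- the energy without cutoff is finite at time `0`
  have hx0 : Summable fun k : ℤ => (|(k : ℝ)| ^ (m + 1)) ^ 2 * x 0 k := by
    refine (((mem_sobolevH_iff.1 hu0).mul_left ((2 * Real.pi / L) ^ 2)).add
      (mem_sobolevH_iff.1 hw0)).congr fun k => ?_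
    simp only [x, hp 0 h0, norm_mul, norm_symb]
    ring
  set M := ∑' k : ℤ, (|(k : ℝ)| ^ (m + 1)) ^ 2 * x 0 k
  have hM : ∀ N, energy (m + 1) N (weakDeriv 1 (u 0)) (w 0) ≤ M := fun N => by
    rw [energy_eq_tsum]
    refine (hxs 0 N).tsum_le_tsum (fun k => ?_) hx0
    gcongr
    · exact weight_nonneg _ _ _
    · exact weight_le_abs _ _ _
  set C := 2 * (rate L m (ENNReal.ofReal (max R₁ R₂ / √L))).toReal
  have hC : 0 ≤ C := by positivity
  have hG := fun N => le_exp_and_lipschitz_of_abs_deriv_le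
    (E := fun s => energy (m + 1) N (weakDeriv 1 (u s)) (w s)) (T := T)
    (fun _ => energy_nonneg _ _ _ _) hC (hM N) fun t ht => by
      obtain ⟨hv, hut, hwt, e1, e2⟩ := hs t ht
      exact exists_hasDerivWithinAt_energy ht hu huc (fun s hs => (hw s hs).1)
        ((hR₁ t ht).trans (le_max_left _ _)) ((hR₂ t ht).trans (le_max_right _ _)) hv hut hwt e1 e2
        m N
  simp only [energy_eq_tsum] at hG
  have hlim := fun t (ht : t ∈ Icc 0 T) =>
    tendsto_tsum_weight_sq_mul (m := m + 1) (hx t) (hxs t) fun N => (hG N).1 t ht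
  set Λ := C * (M * Real.exp (C * T))
  have hlip : ∀ s ∈ Icc 0 T, ∀ t ∈ Icc 0 T, |∑' k : ℤ, (|(k : ℝ)| ^ (m + 1)) ^ 2 * x s k -
      ∑' k : ℤ, (|(k : ℝ)| ^ (m + 1)) ^ 2 * x t k| ≤ Λ * |s - t| := fun s hs t ht =>
    le_of_tendsto ((hlim s hs).2.sub (hlim t ht).2).abs
      (Eventually.of_forall fun N => (hG N).2 s hs t ht)
  let X : ℝ → ℤ → WithLp 2 (ℂ × ℂ) := fun s k =>
    (|(k : ℝ)| ^ (m + 1)) • WithLp.toLp 2 (coef (weakDeriv 1 (u s)) k, coef (w s) k)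
  have hXn : ∀ s k, ‖X s k‖ ^ 2 = (|(k : ℝ)| ^ (m + 1)) ^ 2 * x s k := fun s k => by
    simp only [X, norm_smul, mul_pow, WithLp.prod_norm_sq_eq_of_L2, x]
    simp
  have hXd : ∀ s t k, ‖X s k - X t k‖ ^ 2 = (|(k : ℝ)| ^ (m + 1)) ^ 2 *
      (‖coef (weakDeriv 1 (u s)) k - coef (weakDeriv 1 (u t)) k‖ ^ 2 +
        ‖coef (w s) k - coef (w t) k‖ ^ 2) := fun s t k => by
    simp only [X, ← smul_sub, norm_smul, mul_pow, WithLp.prod_norm_sq_eq_of_L2]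
    simp
  have huH : ∀ t ∈ Icc 0 T, u t ∈ sobolevH L (m + 2) := fun t ht => by
    refine mem_sobolevH_iff.2 (((hlim t ht).1.mul_left (((2 * Real.pi / L) ^ 2)⁻¹)).of_nonneg_of_le
      (fun _ => by positivity) fun k => ?_)
    simp only [x, hp t ht, norm_mul, norm_symb]
    have e : (|(k : ℝ)| ^ (m + 2) * ‖coef (u t) k‖) ^ 2 = ((2 * Real.pi / L) ^ 2)⁻¹ *
        ((|(k : ℝ)| ^ (m + 1)) ^ 2 * (2 * Real.pi / L * |(k : ℝ)| * ‖coef (u t) k‖) ^ 2) := by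
      field_simp
      ring
    rw [e]
    gcongr
    have := sq_nonneg ‖coef (w t) k‖
    linarith
  have hwH' : ∀ t ∈ Icc 0 T, w t ∈ sobolevH L (m + 1) := fun t ht => by
    refine mem_sobolevH_iff.2 ((hlim t ht).1.of_nonneg_of_le (fun _ => by positivity) fun k => ?_)
    rw [mul_pow]
    gcongr
    exact le_add_of_nonneg_left (sq_nonneg _)
  intro t ht
  obtain ⟨-, hut, hwt, -, -⟩ := hs t ht
  have hstrong := tendsto_tsum_norm_sub_sq (l := 𝓝[Icc 0 T] t) (X := X) (Y := X t)
    (by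
      filter_upwards [self_mem_nhdsWithin] with s hs
      simpa only [hXn] using (hlim s hs).1)
    (by simpa only [hXn] using (hlim t ht).1)
    (by
      simp only [hXn]
      rw [tendsto_iff_norm_sub_tendsto_zero]
      have h1 : Tendsto (fun s : ℝ => Λ * |s - t|) (𝓝[Icc 0 T] t) (𝓝 0) := by
        have : Continuous fun s : ℝ => Λ * |s - t| := by fun_prop
        have h := this.tendsto t
        rw [sub_self, abs_zero, mul_zero] at h
        exact h.mono_left nhdsWithin_le_nhds
      refine squeeze_zero' (Eventually.of_forall fun _ => norm_nonneg _) ?_ h1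
      filter_upwards [self_mem_nhdsWithin] with s hs
      exact hlip s hs t ht)
    (by
      intro k
      have h1 : Tendsto (fun s => coef (weakDeriv 1 (u s)) k) (𝓝[Icc 0 T] t)
          (𝓝 (coef (weakDeriv 1 (u t)) k)) := by
        rw [hp t ht]
        refine ((((continuous_coef k).continuousAt.comp_continuousWithinAt
          hut.continuousWithinAt).tendsto).const_mul (symb L k)).congr' ?_
        filter_upwards [self_mem_nhdsWithin] with s hs
        rw [hp s hs]
        rfl
      have h2 : Tendsto (fun s => coef (w s) k) (𝓝[Icc 0 T] t) (𝓝 (coef (w t) k)) :=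
        (continuous_coef k).continuousAt.comp_continuousWithinAt hwt.continuousWithinAt
      exact (((WithLp.prod_continuous_toLp 2 ℂ ℂ).tendsto _).comp
        (h1.prodMk_nhds h2)).const_smul _)
  simp only [hXd] at hstrong
  have hfin : ∀ (B : ℝ) (f : ℝ → ℝ), (∀ s, 0 ≤ f s) → (∀ᶠ s in 𝓝[Icc 0 T] t,
      f s ^ 2 ≤ B * ∑' k : ℤ, (|(k : ℝ)| ^ (m + 1)) ^ 2 *
      (‖coef (weakDeriv 1 (u s)) k - coef (weakDeriv 1 (u t)) k‖ ^ 2 +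
        ‖coef (w s) k - coef (w t) k‖ ^ 2)) → Tendsto f (𝓝[Icc 0 T] t) (𝓝 0) := by
    intro B f hf hle
    have h1 := hstrong.2.const_mul B
    rw [mul_zero] at h1
    have h2 := (squeeze_zero' (Eventually.of_forall fun s => sq_nonneg (f s)) hle h1).sqrt
    simpa only [Real.sqrt_zero, Real.sqrt_sq (hf _)] using h2
  refine ⟨huH t ht, hwH' t ht, hfin (L * (2 * Real.pi / L) ^ (2 * (m + 1))) _
    (fun _ => norm_nonneg _) ?_, hfin (L * (2 * Real.pi / L) ^ (2 * (m + 1))) _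
    (fun _ => norm_nonneg _) ?_⟩
  · filter_upwards [self_mem_nhdsWithin, hstrong.1] with s hs' hsum
    refine hasSum_le (fun k => ?_) (hasSum_norm_weakDeriv_sq (sub_mem_sobolevH (huH s hs') (huH t ht)))
      (hsum.hasSum.mul_left _)
    rw [coef_sub, hp s hs', hp t ht, ← mul_sub, norm_mul, norm_symb]
    have e : L * (2 * Real.pi / L) ^ (2 * (m + 2)) *
        (|(k : ℝ)| ^ (m + 2) * ‖coef (u s) k - coef (u t) k‖) ^ 2 =
        L * (2 * Real.pi / L) ^ (2 * (m + 1)) * ((|(k : ℝ)| ^ (m + 1)) ^ 2 *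
          (2 * Real.pi / L * |(k : ℝ)| * ‖coef (u s) k - coef (u t) k‖) ^ 2) := by
      ring
    rw [e]
    gcongr
    exact le_add_of_nonneg_right (sq_nonneg _)
  · filter_upwards [self_mem_nhdsWithin, hstrong.1] with s hs' hsum
    refine hasSum_le (fun k => ?_) (hasSum_norm_weakDeriv_sq (sub_mem_sobolevH (hwH' s hs') (hwH' t ht)))
      (hsum.hasSum.mul_left _)
    rw [coef_sub, mul_pow (|(k : ℝ)| ^ (m + 1))]
    gcongr
    exact le_add_of_nonneg_left (sq_nonneg _)

/-- Each seminorm of positive order `j ≤ k` is bounded by the top one: frequencies are at least `1`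
in modulus where the symbol does not vanish. -/
theorem norm_weakDeriv_le {j k : ℕ} (hj : j ≠ 0) (hjk : j ≤ k) {f : L2S L}
    (hf : f ∈ sobolevH L k) :
    ‖weakDeriv j f‖ ≤ √((2 * Real.pi / L) ^ (2 * j) / (2 * Real.pi / L) ^ (2 * k)) *
      ‖weakDeriv k f‖ := by
  have hL' := hL.out
  have hpi := Real.pi_pos
  have h1 := hasSum_norm_weakDeriv_sq (sobolevH_mono hjk hf)
  have h2 := (hasSum_norm_weakDeriv_sq hf).mul_left
    ((2 * Real.pi / L) ^ (2 * j) / (2 * Real.pi / L) ^ (2 * k))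
  rw [← pow_le_pow_iff_left₀ (norm_nonneg _) (by positivity) two_ne_zero, mul_pow,
    Real.sq_sqrt (by positivity)]
  refine hasSum_le (fun n => ?_) h1 h2
  have e : (2 * Real.pi / L) ^ (2 * j) / (2 * Real.pi / L) ^ (2 * k) *
      (L * (2 * Real.pi / L) ^ (2 * k) * (|(n : ℝ)| ^ k * ‖coef f n‖) ^ 2) =
      L * (2 * Real.pi / L) ^ (2 * j) * (|(n : ℝ)| ^ k * ‖coef f n‖) ^ 2 := by
    field_simp
  rw [e]
  rcases eq_or_ne n 0 with rfl | hn
  · simp [hj, (Nat.pos_of_ne_zero hj |>.trans_le hjk).ne']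
  · have h1 : (1 : ℝ) ≤ |(n : ℝ)| := by exact_mod_cast Int.one_le_abs hn
    gcongr

theorem continuousInH_of_tendsto {T : ℝ} {k : ℕ} {f : ℝ → L2S L}
    (hf : ∀ t ∈ Icc 0 T, f t ∈ sobolevH L k) (hc : ContinuousOn f (Icc 0 T))
    (h : ∀ t ∈ Icc 0 T, Tendsto (fun s => ‖weakDeriv k (f s - f t)‖) (𝓝[Icc 0 T] t) (𝓝 0)) :
    ContinuousInH k T f := by
  refine fun t ht => ⟨hf t ht, ?_⟩
  have hj : ∀ j ∈ Finset.range (k + 1),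
      Tendsto (fun s => ‖weakDeriv j (f s - f t)‖ ^ 2) (𝓝[Icc 0 T] t) (𝓝 0) := by
    intro j hj
    have hjk : j ≤ k := by simpa [Nat.lt_succ_iff] using hj
    have h1 : Tendsto (fun s => ‖weakDeriv j (f s - f t)‖) (𝓝[Icc 0 T] t) (𝓝 0) := by
      rcases eq_or_ne j 0 with rfl | hj0
      · simp only [weakDeriv_zero]
        exact tendsto_iff_norm_sub_tendsto_zero.1 (hc t ht)
      · have h2 := (h t ht).const_mul
          √((2 * Real.pi / L) ^ (2 * j) / (2 * Real.pi / L) ^ (2 * k))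
        rw [mul_zero] at h2
        refine squeeze_zero' (Eventually.of_forall fun _ => norm_nonneg _) ?_ h2
        filter_upwards [self_mem_nhdsWithin] with s hs
        exact norm_weakDeriv_le hj0 hjk (sub_mem_sobolevH (hf s hs) (hf t ht))
    simpa using h1.pow 2
  have h3 := (tendsto_finsetSum _ hj).sqrt
  rw [Finset.sum_const_zero, Real.sqrt_zero] at h3
  exact h3

theorem norm_weakDeriv_le_normH (k : ℕ) (f : L2S L) : ‖weakDeriv k f‖ ≤ normH k f := by
  rw [normH]
  apply Real.le_sqrt_of_sq_le
  exact Finset.single_le_sum (f := fun j => ‖weakDeriv j f‖ ^ 2) (fun _ _ => sq_nonneg _)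
    (Finset.self_mem_range_succ k)

theorem isSmooth_of_isSmooth {T : ℝ} (hT : 0 ≤ T) {u w : ℝ → L2S L} (hsol : IsSolution T u w)
    (hw : ContinuousInV 1 T w) (hu : ∀ t ∈ Icc 0 T, u t ∈ sobolevH L 2)
    (huc : ContinuousOn (fun t => weakDeriv 2 (u t)) (Icc 0 T))
    (hu0 : IsSmooth (u 0)) (hw0 : IsSmooth (w 0)) :
    ∀ t ∈ Icc 0 T, IsSmooth (u t) ∧ IsSmooth (w t) := by
  intro t ht
  have h := fun m => propagation hT hsol hw hu huc m (mem_sobolevH_of_isSmooth hu0 _)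
    (mem_sobolevH_of_isSmooth hw0 _) t ht
  exact ⟨isSmooth_of_forall_mem_sobolevH fun k => sobolevH_mono (by omega) (h k).1,
    isSmooth_of_forall_mem_sobolevH fun k => sobolevH_mono (by omega) (h k).2.1⟩

end

end

end WallModel

theorem theorem2 (L : ℝ) [Fact (0 < L)] (T : ℝ) (hT : 0 < T) (u w : ℝ → WallModel.L2S L)
    (hsol : WallModel.IsSolution T u w) (hw : WallModel.ContinuousInV 1 T w) :
    (WallModel.ContinuousInV 2 T u →
      (∀ m : ℕ, 1 ≤ m →
        u 0 ∈ WallModel.sobolevV L (m + 1) → w 0 ∈ WallModel.sobolevV L m →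
          WallModel.ContinuousInV (m + 1) T u ∧ WallModel.ContinuousInV m T w) ∧
      (WallModel.IsSmooth (u 0) → WallModel.IsSmooth (w 0) →
        ∀ t ∈ Set.Icc 0 T, WallModel.IsSmooth (u t) ∧ WallModel.IsSmooth (w t))) ∧
    (WallModel.ContinuousInH 2 T u →
      (∀ m : ℕ, 1 ≤ m →
        u 0 ∈ WallModel.sobolevH L (m + 1) → w 0 ∈ WallModel.sobolevV L m →
          WallModel.ContinuousInH (m + 1) T u ∧ WallModel.ContinuousInV m T w) ∧
      (WallModel.IsSmooth (u 0) → WallModel.IsSmooth (w 0) →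
        ∀ t ∈ Set.Icc 0 T, WallModel.IsSmooth (u t) ∧ WallModel.IsSmooth (w t))) := by
  constructor
  · intro hu
    have hu2 : ∀ t ∈ Icc 0 T, u t ∈ WallModel.sobolevH L 2 := fun t ht => (hu t ht).1.1
    have huc := WallModel.continuousOn_weakDeriv hu2 fun t ht => (hu t ht).2
    refine ⟨fun m hm hu0 hw0 => ?_, WallModel.isSmooth_of_isSmooth hT.le hsol hw hu2 huc⟩
    obtain ⟨m, rfl⟩ := Nat.exists_eq_add_of_le' hm
    have h := WallModel.propagation hT.le hsol hw hu2 huc m hu0.1 hw0.1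
    exact ⟨fun t ht => ⟨⟨(h t ht).1, (hu t ht).1.2⟩, (h t ht).2.2.1⟩,
      fun t ht => ⟨⟨(h t ht).2.1, (hw t ht).1.2⟩, (h t ht).2.2.2⟩⟩
  · intro hu
    have hu2 : ∀ t ∈ Icc 0 T, u t ∈ WallModel.sobolevH L 2 := fun t ht => (hu t ht).1
    have huc := WallModel.continuousOn_weakDeriv hu2 fun t ht =>
      squeeze_zero (fun _ => norm_nonneg _)
        (fun _ => WallModel.norm_weakDeriv_le_normH 2 _) (hu t ht).2
    refine ⟨fun m hm hu0 hw0 => ?_, WallModel.isSmooth_of_isSmooth hT.le hsol hw hu2 huc⟩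
    obtain ⟨m, rfl⟩ := Nat.exists_eq_add_of_le' hm
    have h := WallModel.propagation hT.le hsol hw hu2 huc m hu0 hw0.1
    have hcont : ContinuousOn u (Icc 0 T) := by
      obtain ⟨v, ut, wt, hs⟩ := hsol
      exact fun t ht => (hs t ht).2.1.continuousWithinAt
    exact ⟨WallModel.continuousInH_of_tendsto (fun t ht => (h t ht).1) hcont
        fun t ht => (h t ht).2.2.1,
      fun t ht => ⟨⟨(h t ht).2.1, (hw t ht).1.2⟩, (h t ht).2.2.2⟩⟩
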